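/- **Setting.** Let $\Gamma$ be a finite tree with vertex set $V$. Call $U\subseteq V$ connected if it is non-empty and induces a connected subgraph. For $U\subseteq V$ let $$Y_U=\frac{\sum_f\prod_{s\in U}\tilde X_{f,s}}{\prod_{s\in U}X_s}\in \mathrm{Frac}\,\mathbb Z[A_v,X_v:v\in V]$$ be the associated variable of the graph LP algebra of $\Gamma$. Here $f$ runs over the functions $f:U\to V$ such that each $f(s)$ is $s$ or a neighbour of $s$ and the arrows $s\to f(s)$ with $f(s)\ne s$ form no directed cycle; and $\tilde X_{f,s}=A_s$ if $f(s)=s$, $\tilde X_{f,s}=X_{f(s)}$ otherwise. A *nested collection* is a family of connected sets, any two of which are comparable or disjoint, such that for pairwise disjoint members the connected components of their union are exactly these members. Let $\mathcal I$ be a maximal nested collection with union $V$. Let $I_v$ be the smallest member of $\mathcal I$ containing $v$. Order $V$ by $x\le y\iff x\in I_y$. Let $\mathcal C_v$ be the set of vertices covered by $v$, and let $m(U)$ be the largest element of a connected set $U$. Let $\Gamma'$ be the tree obtained by attaching a new vertex $\ell'$ to every leaf $\ell$ of $\Gamma$; the new vertices are larger than all of $V$. Write $[x,y]$ for the vertex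 set of the path from $x$ to $y$, and $N(U)$ for the set of vertices of $\Gamma'$ outside $U$ adjacent to a vertex of $U$. Let $v\in V$ have neighbours $a_1,\dots,a_p$ in $\Gamma'$, those smaller than $v$ being $a_1,\dots,a_r$. Let $c_i=c_i(v)$ be the number of $I\in\mathcal I$ with $a_i\in I$, $v\notin I$; these sets form a chain $I_{a_i}=I^i_{c_i}(v)\subsetneq\dots\subsetneq I^i_1(v)$. Put $a^i_j(v)=m(I^i_j(v))$ for $i\le r$, $1\le j\le c_i$. For a connected set $S$ let $\bar S=\{v\in S: I_v\not\subseteq S\}$ (the rooted portion). $S$ is *weakly rooted* if $\bar S$ is empty, or $\bar S$ is connected and for all $x,y\in\bar S$: $x\le y\iff y\in[x,m(\bar S)]$. **The graph $\mathcal G_S$.** If $S\in\mathcal I$, then $\mathcal G_S$ is a single hyperedge on $N(S)$ of weight $Y_S$. Otherwise it is built as follows. *Component graphs.* Let $v\in\bar S$ (then $r\ge1$), and fix one of the neighbours of $v$ smaller than $v$ as $a_1$. Let $\ell,k$ be leaves of $\Gamma'$ with $a_1\in[v,\ell]$, $a_1\notin[v,k]$, and let $a_i$ be the neighbour of $v$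 on $[v,k]$. For $h\in\{1,i\}$ let $b_{h,j}$ be the vertex other than $v$ of $N(I^h_j)\cap[\ell,k]$. Take the polygon with cyclically ordered vertices $b_{i,1},\dots,b_{i,c_i},a_i,v,a_1,b_{1,c_1},\dots,b_{1,1}$ (labels may repeat), triangulated by the arcs from $v$ to all $b_{h,j}$. The arc from $v$ to $b_{h,j}$ has weight $Y_{I^h_j}$. The boundary arcs have the following weights. 1. $(v,a_1)$ and $(v,a_i)$: weight $1$. 2. $(a_h,b_{h,c_h})$ with $h\le r$: $1$ if it is an edge of $\Gamma'$, otherwise $Y_{I_z}$ with $z\in\mathcal C_{a_h}$, $b_{h,c_h}\in N(I_z)$. 3. $(b_{1,1},b_{i,1})$ if $i\le r$, respectively $(b_{1,1},a_i)$ if $i>r$: $Y_{I_v}$. 4. $(b_{h,j},b_{h,j+1})$, $1\le j<c_h$: $1$ if $b_{h,j}$ is adjacent to $a^h_j$; $Y_{I_z}$ if $b_{h,j}\in N(I_z)$ with $z\in\mathcal C_{a^h_j}\setminus\{a^h_{j+1}\}$. In the remaining case $b_{h,j}\in N(I^h_{j+1})$: $1$ if $b_{h,j}$ is adjacent to a vertex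 of $[v,a^h_j]$, and otherwise $Y_C^2$, where $C$ is the connected component of $I^h_{j+1}\setminus[v,a^h_j]$ containing a vertex adjacent to $b_{h,j}$. The component graph $H_{\ell,k}$ is the surface snake graph of the arc from $a_1$ to $a_i$. It has one tile for each arc $(v,b_{h,j})$, glued from the two triangles at that arc. The arc itself becomes a diagonal labelled $I^h_j$. Each tile has its own copy of $v$, and consecutive tiles are glued along their common side opposite to $v$. Edges keep the weights of the arcs. *The graph $\mathcal G_v$.* Identify vertices of different $H_{\ell,k}$ with the same label and the same position on tiles with the same label. Identify also all copies of $v$ on the diagonals $I^i_1$, $2\le i\le r$, to one vertex $v_{\mathrm{fix}}$. Combine diagonals with the same label. Combine into one hyperedge all edges that have the same weight $\ne1$ and meet the same diagonals, and also all edges of weight $Y_{I_v}$. The vertex $v_{\mathrm{fix}}$ has valence $(r-1)\oplus0$. Any other vertex $x$ has valence $1\oplus b$, where $b$ is the number of edges at $x$ in $\mathcal G_v$ minus the number of edges at $x$ in a component graph (one in which that number is largest). *Trimming.* For every $i\le r$ with $a_i\in S\setminus\bar S$ let $m$ be minimal with $I^i_m\subsetneq S$. Delete all edges of $\mathcal G_v$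 meeting a diagonal with label strictly contained in $I^i_m$ or, if there is no such diagonal, all edges at the vertex labelled $a^i_m$ that lies on no diagonal. Delete the vertices that are left without edges. Lower by one the first coordinate of the valence of the vertex labelled $v$ on the diagonal $I^i_m$. After doing this for all these $i$, delete all diagonals with label contained in one of the sets $I^i_m$, and all vertices of valence $0\oplus0$ together with their incident edges. The result is $\mathcal G_v^S$. *Gluing.* $\mathcal G_S$ is obtained from the graphs $\mathcal G^S_v$, $v\in\bar S$, by identifying, for all adjacent $v,w\in\bar S$, the edge $(v,w)$ of weight $1$ of $\mathcal G_v^S$ whose end labelled $w$ is on no diagonal with the edge $(v,w)$ of weight $1$ of $\mathcal G_w^S$ whose end labelled $v$ is on no diagonal (matching labels). Valences of identified vertices are added, and the first coordinate is lowered by one for each identification. **Theorem.** Let $\Gamma$ be a finite tree, $\mathcal I$ a maximal nested collection on $V$, $S$ a weakly rooted set with respect to $\mathcal I$, and $\mathcal G_S$ a graph constructed as above (for any choice of the neighbours $a_1(v)$, $v\in\bar S$). Then every edge of $\mathcal G_S$ is weighted by a (possibly empty) product of the cluster variables $\{Y_I: I\in\mathcal I\}$, repetitions allowed, if and only if the following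 holds: for every $v\in\bar S$, every $1\le i\le r$ and every $1\le j<c_i(v)$ with $I^i_j(v)\not\subseteq S$, each connected component of $I^i_{j+1}(v)\setminus[v,a^i_j(v)]$ belongs to $\mathcal I$. -/

import Mathlib

namespace GraphLP

/-! ### Graph LP algebra variables -/

section Variables

variable {V : Type*}

/-- The fraction field of `ℤ[A_v, X_v : v ∈ V]`, which contains the graph LP algebra.
The variable `A_v` is indexed by `Sum.inl v` and the initial cluster variable `X_v` by
`Sum.inr v`. -/
abbrev LPField (V : Type*) : Type _ := FractionRing (MvPolynomial (V ⊕ V) ℤ)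

/-- The coefficient variable `A_v`. -/
noncomputable def coeffVar (v : V) : LPField V :=
  algebraMap (MvPolynomial (V ⊕ V) ℤ) (LPField V) (MvPolynomial.X (Sum.inl v))

/-- The initial cluster variable `X_v`. -/
noncomputable def initVar (v : V) : LPField V :=
  algebraMap (MvPolynomial (V ⊕ V) ℤ) (LPField V) (MvPolynomial.X (Sum.inr v))

/-- A function `f : S → V` is acyclic if each `f s` is `s` or a neighbour of `s`, and the directed
graph with an arrow `s → f s` for each `s ∈ S` with `f s ≠ s` has no directed cycle. -/
def IsAcyclicFun (Γ : SimpleGraph V) (S : Finset V) (f : S → V) : Prop :=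
  (∀ s : S, f s = s ∨ Γ.Adj s (f s)) ∧
    ∀ x : V, ¬ Relation.TransGen (fun a b => ∃ h : a ∈ S, f ⟨a, h⟩ = b ∧ b ≠ a) x x

open Classical in
/-- The variable `Y_S` of the graph LP algebra, as an expression in the initial cluster:
`Y_S = (∑_f ∏_{s ∈ S} X̃_{f,s}) / ∏_{s ∈ S} X_s`, where `f` runs over the acyclic functions on `S`
and `X̃_{f,s}` is `A_s` if `f s = s` and `X_{f s}` otherwise (Lam and Pylyavskyy). -/
noncomputable def clusterVar [Fintype V] (Γ : SimpleGraph V) (S : Finset V) : LPField V :=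
  (∑ f : S → V with IsAcyclicFun Γ S f,
      ∏ s : S, (if f s = s then coeffVar (s : V) else initVar (f s))) / ∏ s ∈ S, initVar s

end Variables

/-! ### Nested collections, the induced order, weakly rooted sets -/

section Nested

variable {V : Type*}

/-- `S` induces a connected (in particular nonempty) subgraph. -/
def IsConn (Γ : SimpleGraph V) (S : Set V) : Prop := (Γ.induce S).Connected

/-- `C` is (the vertex set of) a connected component of the subgraph induced on `T`. -/
def IsComponent (Γ : SimpleGraph V) (T : Set V) (C : Finset V) : Prop :=
  Maximal (fun D : Finset V => (D : Set V) ⊆ T ∧ IsConn Γ (D : Set V)) C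

/-- Nested collections of connected vertex subsets. -/
structure IsNested (Γ : SimpleGraph V) (𝓘 : Set (Finset V)) : Prop where
  conn : ∀ I ∈ 𝓘, IsConn Γ (I : Set V)
  laminar : ∀ I ∈ 𝓘, ∀ J ∈ 𝓘, I ⊆ J ∨ J ⊆ I ∨ Disjoint I J
  components : ∀ 𝓙 : Set (Finset V), 𝓙 ⊆ 𝓘 → 𝓙.PairwiseDisjoint id →
    ∀ C : Finset V, IsComponent Γ (⋃ J ∈ 𝓙, (J : Set V)) C ↔ C ∈ 𝓙

/-- Maximal nested collections on the whole vertex set. -/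
structure IsMaxNested (Γ : SimpleGraph V) (𝓘 : Finset (Finset V)) : Prop where
  nested : IsNested Γ (𝓘 : Set (Finset V))
  cover : ∀ v : V, ∃ I ∈ 𝓘, v ∈ I
  maximal : ∀ S : Finset V, IsNested Γ (insert S (𝓘 : Set (Finset V))) → S ∈ 𝓘

open Classical in
/-- `I_v`, the smallest member of `𝓘` containing `v` (the intersection of all of them). The order
induced by `𝓘` is: `x ≤ y` if and only if `x ∈ I_y`. -/
noncomputable def minSet [Fintype V] (𝓘 : Finset (Finset V)) (v : V) : Finset V :=
  {x | ∀ I ∈ 𝓘, v ∈ I → x ∈ I}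

/-- `m = m_𝓘(S)`: the vertex `m` is the largest element of `S` in the order induced by `𝓘`. -/
def IsTop [Fintype V] (𝓘 : Finset (Finset V)) (S : Finset V) (m : V) : Prop :=
  m ∈ S ∧ ∀ s ∈ S, s ∈ minSet 𝓘 m

/-- `z ∈ 𝓒_v`: the vertex `z` is covered by `v` in the order induced by `𝓘`. -/
def IsCovered [Fintype V] (𝓘 : Finset (Finset V)) (v z : V) : Prop :=
  z ∈ minSet 𝓘 v ∧ z ≠ v ∧ ∀ y, z ∈ minSet 𝓘 y → y ∈ minSet 𝓘 v → y = z ∨ y = v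

/-- `[x, y]`: the vertices lying on a path from `x` to `y` (the path is unique in a tree). -/
def pathSet {α : Type*} (G : SimpleGraph α) (x y : α) : Set α :=
  {z | ∃ p : G.Walk x y, p.IsPath ∧ z ∈ p.support}

/-- `a` is one of the `a_1, …, a_r`: a neighbour of `v` that is smaller than `v`. -/
def IsLower [Fintype V] (Γ : SimpleGraph V) (𝓘 : Finset (Finset V)) (v a : V) : Prop :=
  Γ.Adj v a ∧ a ∈ minSet 𝓘 v

open Classical in
/-- The members of `𝓘` that contain `a` but not `v`. -/
noncomputable def branchSets (𝓘 : Finset (Finset V)) (v a : V) : Finset (Finset V) :=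
  {I ∈ 𝓘 | a ∈ I ∧ v ∉ I}

/-- `c_i(v)` for `a = a_i(v)`. -/
noncomputable def branchLen (𝓘 : Finset (Finset V)) (v a : V) : ℕ := (branchSets 𝓘 v a).card

open Classical in
/-- `I^i_j(v)` for `a = a_i(v)` and `1 ≤ j ≤ c_i(v)`: the `j`-th largest of the (totally ordered)
members of `𝓘` that contain `a` but not `v`, that is, the one contained in exactly `j` of them. -/
noncomputable def branchSet [Fintype V] (𝓘 : Finset (Finset V)) (v a : V) (j : ℕ) : Finset V :=
  {x | ∃ J ∈ branchSets 𝓘 v a, ((branchSets 𝓘 v a).filter (fun K => J ⊆ K)).card = j ∧ x ∈ J}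

open Classical in
/-- The rooted portion `S̄ = {v ∈ S : I_v ⊄ S}`. -/
noncomputable def rootedPortion [Fintype V] (𝓘 : Finset (Finset V)) (S : Finset V) : Finset V :=
  {v ∈ S | ¬ minSet 𝓘 v ⊆ S}

/-- The order condition in the definition of a rooted set: for `i, j ∈ S`, `i ≤ j` if and only if
`j ∈ [i, m_𝓘(S)]`. -/
def IsRooted [Fintype V] (Γ : SimpleGraph V) (𝓘 : Finset (Finset V)) (S : Finset V) : Prop :=
  ∀ m, IsTop 𝓘 S m → ∀ i ∈ S, ∀ j ∈ S, (i ∈ minSet 𝓘 j ↔ j ∈ pathSet Γ i m)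

/-- A connected set `S` is weakly rooted if `S̄` is a connected rooted set. The empty set is allowed
for `S̄`, so that the members of `𝓘` are weakly rooted. -/
structure IsWeaklyRooted [Fintype V] (Γ : SimpleGraph V) (𝓘 : Finset (Finset V))
    (S : Finset V) : Prop where
  conn : IsConn Γ (S : Set V)
  conn_rooted : (Γ.induce (rootedPortion 𝓘 S : Set V)).Preconnected
  rooted : IsRooted Γ 𝓘 (rootedPortion 𝓘 S)

end Nested

/-! ### The extended tree `Γ'` -/

section Extended

variable {V : Type*}

/-- Vertices of degree one. -/
def IsLeaf {α : Type*} (G : SimpleGraph α) (x : α) : Prop := (G.neighborSet x).ncard = 1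

/-- Vertices of `Γ'`: those of `Γ`, and a new vertex `ℓ'` for each leaf `ℓ` of `Γ`. -/
abbrev ExtVertex (Γ : SimpleGraph V) : Type _ := V ⊕ {l : V // IsLeaf Γ l}

/-- Adjacency in `Γ'`: that of `Γ`, and each `ℓ'` is adjacent to `ℓ` only. -/
def extAdj (Γ : SimpleGraph V) : ExtVertex Γ → ExtVertex Γ → Prop
  | .inl x, .inl y => Γ.Adj x y
  | .inl x, .inr l => x = l
  | .inr l, .inl y => y = l
  | .inr _, .inr _ => False

/-- The extended tree `Γ'`. -/
def extGraph (Γ : SimpleGraph V) : SimpleGraph (ExtVertex Γ) where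
  Adj := extAdj Γ
  symm := ⟨by
    rintro (x | l) (y | l') h
    · exact Γ.adj_symm h
    · exact h
    · exact h
    · exact h⟩
  loopless := ⟨by
    rintro (x | l) h
    · exact Γ.loopless.irrefl x h
    · exact h⟩

/-- `N_{Γ'}(S)` for a set `S` of vertices of `Γ`. -/
def extNbrs (Γ : SimpleGraph V) (S : Finset V) : Set (ExtVertex Γ) :=
  {x | (∀ s ∈ S, x ≠ .inl s) ∧ ∃ s ∈ S, (extGraph Γ).Adj (.inl s) x}

/-- `x > v` in the extended order on `V(Γ')`, in which the new vertices lie above all of `V(Γ)`. -/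
def ExtGreater [Fintype V] (Γ : SimpleGraph V) (𝓘 : Finset (Finset V)) (v : V) :
    ExtVertex Γ → Prop
  | .inl w => v ∈ minSet 𝓘 w ∧ w ≠ v
  | .inr _ => True

end Extended

/-! ### Hypergraphs with diagonals and valences -/

/-- Names for the vertices of the snake graphs. The first four kinds belong to the snake graph of
the singleton `{v}`; each name records a label (a vertex of `Γ'`) and the position relative to the
diagonals, which is exactly the data up to which the vertices of the component snake graphs
of `v` are identified.
* `apex v I`: the vertex labelled `v` on the diagonal labelled `I`;
* `fix v`: the vertex `v_fix`, labelled `v`, common to several diagonals;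
* `far v I x`: the vertex labelled `x ∈ N_{Γ'}(I)`, `x ≠ v`, on the diagonal labelled `I`;
* `tip v x`: the vertex labelled by the neighbour `x` of `v`, which is on no diagonal.
* `solo x`: the vertex labelled `x` in a snake graph that consists of a single hyperedge. -/
inductive SnakeVertex (V W : Type*) where
  | apex (v : V) (I : Finset V)
  | fix (v : V)
  | far (v : V) (I : Finset V) (x : W)
  | tip (v : V) (x : W)
  | solo (x : W)

/-- A weighted hypergraph with labelled diagonals and valences. An edge is a pair of its set of
endpoints and its weight; a diagonal is a pair of its label and its set of endpoints; the pair
`valence x = (a, b)` stands for the valence `a ⊕ b`. -/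
structure SnakeGraph (V W K : Type*) where
  vertices : Set (SnakeVertex V W)
  edges : Set (Set (SnakeVertex V W) × K)
  diagonals : Set (Finset V × Set (SnakeVertex V W))
  valence : SnakeVertex V W → ℕ × ℕ

/-! ### Component snake graphs -/

section Construction

variable {V : Type*} [Fintype V]

/-- The vertices used for the snake graphs over `Γ`. -/
abbrev SVert (Γ : SimpleGraph V) : Type _ := SnakeVertex V (ExtVertex Γ)

/-- A pair of leaves `(ℓ, k) ∈ A × B` of `Γ'`, where `a₁` is the chosen first neighbour of `v`. -/
def IsLeafPair (Γ : SimpleGraph V) (v a₁ : V) (l k : ExtVertex Γ) : Prop :=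
  IsLeaf (extGraph Γ) l ∧ IsLeaf (extGraph Γ) k ∧
    Sum.inl a₁ ∈ pathSet (extGraph Γ) (.inl v) l ∧ Sum.inl a₁ ∉ pathSet (extGraph Γ) (.inl v) k

/-- `b = b^{ℓ,k}_{i,j}` for `I = I^i_j(v)`: the vertex other than `v` in `N_{Γ'}(I) ∩ [ℓ, k]`. -/
def IsExit (Γ : SimpleGraph V) (v : V) (l k : ExtVertex Γ) (I : Finset V) (b : ExtVertex Γ) :
    Prop :=
  b ≠ .inl v ∧ b ∈ extNbrs Γ I ∧ b ∈ pathSet (extGraph Γ) l k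

/-- `a` is a neighbour of `v` smaller than `v` on the path `[ℓ, k]` (so `a = a_1`, or `a` is the
neighbour `a_i` of `v` towards `k` and `i ≤ r`). -/
def OnBranch (Γ : SimpleGraph V) (𝓘 : Finset (Finset V)) (v : V) (l k : ExtVertex Γ) (a : V) :
    Prop :=
  IsLower Γ 𝓘 v a ∧ Sum.inl a ∈ pathSet (extGraph Γ) l k

/-- The weighted boundary arcs, not containing `v`, of the triangulated polygon `T_{ℓ,k}`. The
vertices of the polygon are, in cyclic order, `b_{i,1}, …, b_{i,c_i}, a_i, v, a_1, b_{1,c_1}, …,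
b_{1,1}`. The vertex `b_{i,j}` is written `far v I^i_j b_{i,j}` and `a_i` is written `tip v a_i`.
All internal arcs of the triangulation join `v` to the vertices `b_{i,j}`. -/
inductive RimArc (Γ : SimpleGraph V) (𝓘 : Finset (Finset V)) (v a₁ : V) (l k : ExtVertex Γ) :
    SVert Γ → SVert Γ → LPField V → Prop
  /-- The arc `(a_i, b_{i,c_i})` when it is an edge of `Γ'`. -/
  | tip_adj (a : V) (b : ExtVertex Γ) (ha : OnBranch Γ 𝓘 v l k a)
      (hb : IsExit Γ v l k (branchSet 𝓘 v a (branchLen 𝓘 v a)) b)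
      (hadj : (extGraph Γ).Adj (.inl a) b) :
      RimArc Γ 𝓘 v a₁ l k (.tip v (.inl a))
        (.far v (branchSet 𝓘 v a (branchLen 𝓘 v a)) b) 1
  /-- The arc `(a_i, b_{i,c_i})` when it is not an edge of `Γ'`. -/
  | tip_cover (a : V) (b : ExtVertex Γ) (z : V) (ha : OnBranch Γ 𝓘 v l k a)
      (hb : IsExit Γ v l k (branchSet 𝓘 v a (branchLen 𝓘 v a)) b)
      (hadj : ¬ (extGraph Γ).Adj (.inl a) b)
      (hz : IsCovered 𝓘 a z) (hbz : b ∈ extNbrs Γ (minSet 𝓘 z)) :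
      RimArc Γ 𝓘 v a₁ l k (.tip v (.inl a))
        (.far v (branchSet 𝓘 v a (branchLen 𝓘 v a)) b) (clusterVar Γ (minSet 𝓘 z))
  /-- The arc `(b_{i,j}, b_{i,j+1})` when `b_{i,j}` is adjacent to `u = a^i_j`. -/
  | step_adj (a : V) (j : ℕ) (b b' : ExtVertex Γ) (u : V) (ha : OnBranch Γ 𝓘 v l k a)
      (hj : 1 ≤ j) (hjc : j < branchLen 𝓘 v a)
      (hb : IsExit Γ v l k (branchSet 𝓘 v a j) b)
      (hb' : IsExit Γ v l k (branchSet 𝓘 v a (j + 1)) b')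
      (hu : IsTop 𝓘 (branchSet 𝓘 v a j) u)
      (hadj : (extGraph Γ).Adj (.inl u) b) :
      RimArc Γ 𝓘 v a₁ l k (.far v (branchSet 𝓘 v a j) b)
        (.far v (branchSet 𝓘 v a (j + 1)) b') 1
  /-- The arc `(b_{i,j}, b_{i,j+1})` when `b_{i,j} ∈ N_{Γ'}(I_z)` for some `z` covered by `u = a^i_j`
  other than `w = a^i_{j+1}`. -/
  | step_cover (a : V) (j : ℕ) (b b' : ExtVertex Γ) (u w z : V) (ha : OnBranch Γ 𝓘 v l k a)
      (hj : 1 ≤ j) (hjc : j < branchLen 𝓘 v a)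
      (hb : IsExit Γ v l k (branchSet 𝓘 v a j) b)
      (hb' : IsExit Γ v l k (branchSet 𝓘 v a (j + 1)) b')
      (hu : IsTop 𝓘 (branchSet 𝓘 v a j) u)
      (hw : IsTop 𝓘 (branchSet 𝓘 v a (j + 1)) w)
      (hz : IsCovered 𝓘 u z) (hzw : z ≠ w) (hbz : b ∈ extNbrs Γ (minSet 𝓘 z)) :
      RimArc Γ 𝓘 v a₁ l k (.far v (branchSet 𝓘 v a j) b)
        (.far v (branchSet 𝓘 v a (j + 1)) b') (clusterVar Γ (minSet 𝓘 z))
  /-- The arc `(b_{i,j}, b_{i,j+1})` when `b_{i,j} ∈ N_{Γ'}(I^i_{j+1})` and `b_{i,j}` is adjacent to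
  a vertex of `[v, a^i_j]`. -/
  | step_one (a : V) (j : ℕ) (b b' : ExtVertex Γ) (u : V) (ha : OnBranch Γ 𝓘 v l k a)
      (hj : 1 ≤ j) (hjc : j < branchLen 𝓘 v a)
      (hb : IsExit Γ v l k (branchSet 𝓘 v a j) b)
      (hb' : IsExit Γ v l k (branchSet 𝓘 v a (j + 1)) b')
      (hu : IsTop 𝓘 (branchSet 𝓘 v a j) u)
      (hbn : b ∈ extNbrs Γ (branchSet 𝓘 v a (j + 1)))
      (hadj : ∃ y ∈ pathSet Γ v u, (extGraph Γ).Adj (.inl y) b) :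
      RimArc Γ 𝓘 v a₁ l k (.far v (branchSet 𝓘 v a j) b)
        (.far v (branchSet 𝓘 v a (j + 1)) b') 1
  /-- The arc `(b_{i,j}, b_{i,j+1})` when `b_{i,j} ∈ N_{Γ'}(I^i_{j+1})` and `b_{i,j}` is not adjacent
  to a vertex of `[v, a^i_j]`; here `C` is the connected component of `I^i_{j+1} ∖ [v, a^i_j]` that
  contains a vertex adjacent to `b_{i,j}`. -/
  | step_square (a : V) (j : ℕ) (b b' : ExtVertex Γ) (u : V) (C : Finset V)
      (ha : OnBranch Γ 𝓘 v l k a)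
      (hj : 1 ≤ j) (hjc : j < branchLen 𝓘 v a)
      (hb : IsExit Γ v l k (branchSet 𝓘 v a j) b)
      (hb' : IsExit Γ v l k (branchSet 𝓘 v a (j + 1)) b')
      (hu : IsTop 𝓘 (branchSet 𝓘 v a j) u)
      (hbn : b ∈ extNbrs Γ (branchSet 𝓘 v a (j + 1)))
      (hadj : ¬ ∃ y ∈ pathSet Γ v u, (extGraph Γ).Adj (.inl y) b)
      (hC : IsComponent Γ ((branchSet 𝓘 v a (j + 1) : Set V) \ pathSet Γ v u) C)
      (hCb : ∃ y ∈ C, (extGraph Γ).Adj (.inl y) b) :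
      RimArc Γ 𝓘 v a₁ l k (.far v (branchSet 𝓘 v a j) b)
        (.far v (branchSet 𝓘 v a (j + 1)) b') (clusterVar Γ C ^ 2)
  /-- The arc `(b_{1,1}, b_{i,1})` when `i ≤ r`. -/
  | cap_lower (a : V) (b b' : ExtVertex Γ) (ha : OnBranch Γ 𝓘 v l k a) (hne : a ≠ a₁)
      (hb : IsExit Γ v l k (branchSet 𝓘 v a₁ 1) b)
      (hb' : IsExit Γ v l k (branchSet 𝓘 v a 1) b') :
      RimArc Γ 𝓘 v a₁ l k (.far v (branchSet 𝓘 v a₁ 1) b) (.far v (branchSet 𝓘 v a 1) b')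
        (clusterVar Γ (minSet 𝓘 v))
  /-- The arc `(b_{1,1}, a_i)` when `i > r`. -/
  | cap_greater (x b : ExtVertex Γ) (hx : (extGraph Γ).Adj (.inl v) x)
      (hxg : ExtGreater Γ 𝓘 v x) (hxp : x ∈ pathSet (extGraph Γ) l k)
      (hb : IsExit Γ v l k (branchSet 𝓘 v a₁ 1) b) :
      RimArc Γ 𝓘 v a₁ l k (.far v (branchSet 𝓘 v a₁ 1) b) (.tip v x)
        (clusterVar Γ (minSet 𝓘 v))

/-- The weight of the arc of `T_{ℓ,k}` joining `v` to another vertex of the polygon: `Y_{I^i_j}`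
for the internal arc to `b_{i,j}`, and `1` for the boundary arc to a neighbour of `v`. -/
noncomputable def spokeWeight (Γ : SimpleGraph V) : SVert Γ → LPField V
  | .far _ I _ => clusterVar Γ I
  | _ => 1

open Classical in
/-- The vertex labelled `v` on the diagonal labelled `I` of the snake graph of `v`. Each tile of a
component snake graph has its own copy of `v`; after gluing, the copies on the diagonals `I^i_1`,
`2 ≤ i ≤ r`, are all identified to `v_fix`. -/
noncomputable def apexOf (Γ : SimpleGraph V) (𝓘 : Finset (Finset V)) (v a₁ : V) (I : Finset V) :
    SVert Γ :=
  if ∃ a, IsLower Γ 𝓘 v a ∧ a ≠ a₁ ∧ I = branchSet 𝓘 v a 1 then .fix v else .apex v I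

/-- The edges of the component snake graph `H_{ℓ,k}`. The tile of the internal arc from `v` to
`p = b_{i,j}` is glued from the two triangles of `T_{ℓ,k}` with that side, and it has a copy of `v`
of its own. A triangle with vertices `v, p, q` thus contributes to this tile the edge `pq` and
the edge from its copy of `v` to `q`. If `q` is also the end of an internal arc, the tiles of the
two arcs are glued along `pq`. -/
inductive ComponentEdge (Γ : SimpleGraph V) (𝓘 : Finset (Finset V)) (v a₁ : V)
    (l k : ExtVertex Γ) : SVert Γ → SVert Γ → LPField V → Prop
  | rim {p q : SVert Γ} {w : LPField V} (h : RimArc Γ 𝓘 v a₁ l k p q w) :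
      ComponentEdge Γ 𝓘 v a₁ l k p q w
  | spoke_right {I : Finset V} {b : ExtVertex Γ} {q : SVert Γ} {w : LPField V}
      (h : RimArc Γ 𝓘 v a₁ l k (.far v I b) q w) :
      ComponentEdge Γ 𝓘 v a₁ l k (apexOf Γ 𝓘 v a₁ I) q (spokeWeight Γ q)
  | spoke_left {I : Finset V} {b : ExtVertex Γ} {p : SVert Γ} {w : LPField V}
      (h : RimArc Γ 𝓘 v a₁ l k p (.far v I b) w) :
      ComponentEdge Γ 𝓘 v a₁ l k (apexOf Γ 𝓘 v a₁ I) p (spokeWeight Γ p)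

/-- The edges of `H_{ℓ,k}` as weighted sets of endpoints. -/
def componentEdges (Γ : SimpleGraph V) (𝓘 : Finset (Finset V)) (v a₁ : V) (l k : ExtVertex Γ) :
    Set (Set (SVert Γ) × LPField V) :=
  {e | ∃ p q, ComponentEdge Γ 𝓘 v a₁ l k p q e.2 ∧ e.1 = {p, q}}

/-! ### Snake graphs of singletons -/

/-- The edges of all component snake graphs of `v`, before edges are combined. -/
def rawEdges (Γ : SimpleGraph V) (𝓘 : Finset (Finset V)) (v a₁ : V) :
    Set (Set (SVert Γ) × LPField V) :=
  {e | ∃ l k, IsLeafPair Γ v a₁ l k ∧ e ∈ componentEdges Γ 𝓘 v a₁ l k}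

/-- The diagonals of the snake graph of `v`: the diagonals with the same label in all component
snake graphs are combined. -/
def singletonDiagonals (Γ : SimpleGraph V) (𝓘 : Finset (Finset V)) (v a₁ : V) :
    Set (Finset V × Set (SVert Γ)) :=
  {d | ∃ a, IsLower Γ 𝓘 v a ∧ d.1 ∈ branchSets 𝓘 v a ∧
    d.2 = {x | ∃ l k, IsLeafPair Γ v a₁ l k ∧ OnBranch Γ 𝓘 v l k a ∧
      (x = apexOf Γ 𝓘 v a₁ d.1 ∨ ∃ b, IsExit Γ v l k d.1 b ∧ x = .far v d.1 b)}}

/-- The labels of the diagonals that have an endpoint in `E`. -/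
def meetingLabels {Γ : SimpleGraph V} (D : Set (Finset V × Set (SVert Γ))) (E : Set (SVert Γ)) :
    Set (Finset V) :=
  {I | ∃ d ∈ D, d.1 = I ∧ (d.2 ∩ E).Nonempty}

/-- Two edges are combined when they have the same weight, different from `1`, and are adjacent to
the same diagonals; all edges of weight `Y_{I_v}` are combined. In this way every edge of weight
`Y_I` is incident to exactly one vertex labelled `x` for each `x ∈ N_{Γ'}(I)`, and every edge of
weight `Y_C ^ 2`, on the tiles `I^i_j` and `I^i_{j+1}`, to two for each
`x ∈ N_{Γ'}(C) ∖ [v, a^i_j]`. -/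
def Combinable (Γ : SimpleGraph V) (𝓘 : Finset (Finset V)) (v a₁ : V)
    (e e' : Set (SVert Γ) × LPField V) : Prop :=
  e'.2 = e.2 ∧ e.2 ≠ 1 ∧
    (meetingLabels (singletonDiagonals Γ 𝓘 v a₁) e'.1 =
        meetingLabels (singletonDiagonals Γ 𝓘 v a₁) e.1 ∨
      e.2 = clusterVar Γ (minSet 𝓘 v))

/-- The hyperedges of the snake graph of `v`. -/
def singletonEdges (Γ : SimpleGraph V) (𝓘 : Finset (Finset V)) (v a₁ : V) :
    Set (Set (SVert Γ) × LPField V) :=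
  {f | ∃ e ∈ rawEdges Γ 𝓘 v a₁, f.2 = e.2 ∧
    f.1 = e.1 ∪ {x | ∃ e' ∈ rawEdges Γ 𝓘 v a₁, Combinable Γ 𝓘 v a₁ e e' ∧ x ∈ e'.1}}

/-- The number of edges incident to `x`. -/
noncomputable def edgeDegree {Γ : SimpleGraph V} (E : Set (Set (SVert Γ) × LPField V))
    (x : SVert Γ) : ℕ :=
  {e ∈ E | x ∈ e.1}.ncard

/-- The snake graph of `v` when `{v} ∉ 𝓘`. The valence of `v_fix` is `(r - 1) ⊕ 0`. The valence of
any other vertex is `1 ⊕ b`, where `b` is the number of edges incident to it in excess of those in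
a component snake graph. -/
noncomputable def singletonGraph (Γ : SimpleGraph V) (𝓘 : Finset (Finset V)) (v a₁ : V) :
    SnakeGraph V (ExtVertex Γ) (LPField V) where
  vertices := {x | ∃ e ∈ rawEdges Γ 𝓘 v a₁, x ∈ e.1}
  edges := singletonEdges Γ 𝓘 v a₁
  diagonals := singletonDiagonals Γ 𝓘 v a₁
  valence
    | .fix _ => ({a | IsLower Γ 𝓘 v a}.ncard - 1, 0)
    | x => (1, edgeDegree (singletonEdges Γ 𝓘 v a₁) x -
        sSup {d | ∃ l k, IsLeafPair Γ v a₁ l k ∧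
          d = edgeDegree (componentEdges Γ 𝓘 v a₁ l k) x})

/-! ### Snake graphs of weakly rooted sets -/

/-- The branch of the snake graph of `v` at `a` is trimmed at level `m`: the vertex `a` is a
neighbour of `v` smaller than `v` in `S ∖ S̄`, and `m` is minimal with `1 ≤ m ≤ c_i(v)` and
`I^i_m(v) ⊊ S`, where `a = a_i(v)`. -/
def IsTrimmed (Γ : SimpleGraph V) (𝓘 : Finset (Finset V)) (S : Finset V) (v a : V) (m : ℕ) :
    Prop :=
  IsLower Γ 𝓘 v a ∧ a ∈ S ∧ a ∉ rootedPortion 𝓘 S ∧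
    IsLeast {n | 1 ≤ n ∧ n ≤ branchLen 𝓘 v a ∧ branchSet 𝓘 v a n ⊂ S} m

/-- The edges with endpoint set `E` are deleted when the branch at `a` is trimmed at level `m`:
either `E` meets a diagonal whose label is strictly contained in `I^i_m(v)`, or there is no such
diagonal and `E` contains the vertex labelled `a^i_m` that is not on the diagonals. -/
def IsCutEdge (Γ : SimpleGraph V) (𝓘 : Finset (Finset V)) (v a₁ a : V) (m : ℕ)
    (E : Set (SVert Γ)) : Prop :=
  (∃ d ∈ singletonDiagonals Γ 𝓘 v a₁, d.1 ⊂ branchSet 𝓘 v a m ∧ (d.2 ∩ E).Nonempty) ∨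
    ((¬ ∃ d ∈ singletonDiagonals Γ 𝓘 v a₁, d.1 ⊂ branchSet 𝓘 v a m) ∧
      ∃ u, IsTop 𝓘 (branchSet 𝓘 v a m) u ∧ SnakeVertex.tip v (.inl u) ∈ E)

/-- The edges of the snake graph of `v` that remain after the first deletion. -/
def keptEdges (Γ : SimpleGraph V) (𝓘 : Finset (Finset V)) (S : Finset V) (v a₁ : V) :
    Set (Set (SVert Γ) × LPField V) :=
  {e ∈ singletonEdges Γ 𝓘 v a₁ | ∀ a m, IsTrimmed Γ 𝓘 S v a m → ¬ IsCutEdge Γ 𝓘 v a₁ a m e.1}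

/-- The valence after trimming: the first coordinate is lowered by one for each trimmed branch for
which the vertex is the one labelled `v` on the diagonal `I^i_m(v)`. -/
noncomputable def trimmedValence (Γ : SimpleGraph V) (𝓘 : Finset (Finset V)) (S : Finset V)
    (v a₁ : V) (x : SVert Γ) : ℕ × ℕ :=
  (((singletonGraph Γ 𝓘 v a₁).valence x).1 -
      {a | ∃ m, IsTrimmed Γ 𝓘 S v a m ∧ x = apexOf Γ 𝓘 v a₁ (branchSet 𝓘 v a m)}.ncard,
    ((singletonGraph Γ 𝓘 v a₁).valence x).2)

/-- The vertices that remain after trimming: the ones that are incident to a remaining edge after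
the first deletion, and do not have valence `0 ⊕ 0`. -/
def trimmedVertices (Γ : SimpleGraph V) (𝓘 : Finset (Finset V)) (S : Finset V) (v a₁ : V) :
    Set (SVert Γ) :=
  {x | (∃ e ∈ keptEdges Γ 𝓘 S v a₁, x ∈ e.1) ∧ trimmedValence Γ 𝓘 S v a₁ x ≠ (0, 0)}

/-- The trimmed snake graph `𝓖_v^S` of a vertex `v ∈ S̄`. The edges incident to a vertex of valence
`0 ⊕ 0` are deleted, and so are the diagonals whose label is contained in some `I^i_m(v)` at which
a branch is trimmed. -/
noncomputable def trimmedGraph (Γ : SimpleGraph V) (𝓘 : Finset (Finset V)) (S : Finset V)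
    (v a₁ : V) : SnakeGraph V (ExtVertex Γ) (LPField V) where
  vertices := trimmedVertices Γ 𝓘 S v a₁
  edges := {e ∈ keptEdges Γ 𝓘 S v a₁ | ∀ x ∈ e.1, trimmedValence Γ 𝓘 S v a₁ x ≠ (0, 0)}
  diagonals := {d | ∃ d₀ ∈ singletonDiagonals Γ 𝓘 v a₁, d.1 = d₀.1 ∧
    d.2 = d₀.2 ∩ trimmedVertices Γ 𝓘 S v a₁ ∧
    ∀ a m, IsTrimmed Γ 𝓘 S v a m → ¬ d.1 ⊆ branchSet 𝓘 v a m}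
  valence := trimmedValence Γ 𝓘 S v a₁

open Classical in
/-- For adjacent vertices `v`, `w` of `Γ`, the endpoint labelled `v` of the edge `(v, w)` of the
snake graph of `v` whose other endpoint is `tip v w`. It is on the diagonal `I_w` if `w < v`,
and it is `v_opt`, on the diagonal `I^1_1(v)`, otherwise. -/
noncomputable def gluingVertex (Γ : SimpleGraph V) (𝓘 : Finset (Finset V)) (v a₁ w : V) :
    SVert Γ :=
  if w ∈ minSet 𝓘 v then apexOf Γ 𝓘 v a₁ (minSet 𝓘 w)
  else apexOf Γ 𝓘 v a₁ (branchSet 𝓘 v a₁ 1)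

open Classical in
/-- The identification of vertices that glues, for all adjacent `v, w ∈ S̄`, the edge `(v, w)` of
`𝓖_v^S` to the edge `(v, w)` of `𝓖_w^S`: the vertex `tip v w` of the former is identified
with the endpoint labelled `w` of the latter. Every class of identified vertices contains
exactly one vertex that is not of the form `tip v w` with `v, w ∈ S̄`, and it is used as a
representative. -/
noncomputable def glueMap (Γ : SimpleGraph V) (𝓘 : Finset (Finset V)) (S : Finset V)
    (a₁ : V → V) : SVert Γ → SVert Γ
  | .tip v (.inl w) =>
      if v ∈ rootedPortion 𝓘 S ∧ w ∈ rootedPortion 𝓘 S then gluingVertex Γ 𝓘 w (a₁ w) v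
      else .tip v (.inl w)
  | x => x

/-- The vertices of `𝓖_v^S` that are glued to `x`. -/
def glueFiber (Γ : SimpleGraph V) (𝓘 : Finset (Finset V)) (S : Finset V) (a₁ : V → V)
    (x : SVert Γ) (v : V) : Set (SVert Γ) :=
  {y ∈ (trimmedGraph Γ 𝓘 S v (a₁ v)).vertices | glueMap Γ 𝓘 S a₁ y = x}

/-- The graph obtained by gluing the trimmed snake graphs `𝓖_v^S` for all `v ∈ S̄`. When vertices
are identified their valences are added, and the first coordinate is lowered by one for each
identification. -/
noncomputable def gluedGraph (Γ : SimpleGraph V) (𝓘 : Finset (Finset V)) (S : Finset V)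
    (a₁ : V → V) : SnakeGraph V (ExtVertex Γ) (LPField V) where
  vertices := {x | ∃ v ∈ rootedPortion 𝓘 S,
    x ∈ glueMap Γ 𝓘 S a₁ '' (trimmedGraph Γ 𝓘 S v (a₁ v)).vertices}
  edges := {f | ∃ v ∈ rootedPortion 𝓘 S, ∃ e ∈ (trimmedGraph Γ 𝓘 S v (a₁ v)).edges,
    f = (glueMap Γ 𝓘 S a₁ '' e.1, e.2)}
  diagonals := {f | ∃ v ∈ rootedPortion 𝓘 S, ∃ d ∈ (trimmedGraph Γ 𝓘 S v (a₁ v)).diagonals,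
    f = (d.1, glueMap Γ 𝓘 S a₁ '' d.2)}
  valence x :=
    ((∑ v ∈ rootedPortion 𝓘 S, ∑ᶠ y ∈ glueFiber Γ 𝓘 S a₁ x v,
          (trimmedValence Γ 𝓘 S v (a₁ v) y).1) -
        ((∑ v ∈ rootedPortion 𝓘 S, (glueFiber Γ 𝓘 S a₁ x v).ncard) - 1),
      ∑ v ∈ rootedPortion 𝓘 S, ∑ᶠ y ∈ glueFiber Γ 𝓘 S a₁ x v,
          (trimmedValence Γ 𝓘 S v (a₁ v) y).2)

/-- The snake graph of a member `S` of `𝓘`: a single hyperedge of weight `Y_S` connecting all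
vertices of `N_{Γ'}(S)`. -/
noncomputable def hyperedgeGraph (Γ : SimpleGraph V) (S : Finset V) :
    SnakeGraph V (ExtVertex Γ) (LPField V) where
  vertices := SnakeVertex.solo '' extNbrs Γ S
  edges := {(SnakeVertex.solo '' extNbrs Γ S, clusterVar Γ S)}
  diagonals := ∅
  valence _ := (1, 0)

open Classical in
/-- The snake graph `𝓖_S` of a weakly rooted set `S`, for a choice `a₁ v` of the first smaller
neighbour of each `v ∈ S̄`. -/
noncomputable def snakeGraph (Γ : SimpleGraph V) (𝓘 : Finset (Finset V)) (S : Finset V)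
    (a₁ : V → V) : SnakeGraph V (ExtVertex Γ) (LPField V) :=
  if S ∈ 𝓘 then hyperedgeGraph Γ S else gluedGraph Γ 𝓘 S a₁

end Construction

end GraphLP

/-! The weights of the snake graph `𝓖_S` are of three kinds: `1`, variables `Y_I` with `I ∈ 𝓘`, and
squares `Y_C ^ 2`, where `C` is a component of `I^i_{j+1} ∖ [v, a^i_j]`. Only the squares matter, and
three facts about them give the theorem.

* Every component `C` of `I^i_{j+1} ∖ [v, a^i_j]` occurs in a weight of the untrimmed graph of `v`:
  a path from `v` through `C` to a new vertex of the extended tree has to leave `C`, and it does so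
  at a vertex `b` outside `I^i_j`, which is then the common exit `b_{i,j} = b_{i,j+1}` of a suitable
  pair of leaves (`exists_rimArc_of_isComponent`).
* The edge between the tiles `I^i_j` and `I^i_{j+1}` with this weight survives the trimming exactly
  when `I^i_j ⊈ S` (`not_subset_of_mem_keptEdges`, `exists_mem_trimmedGraph_edges`): otherwise
  `I^i_{j+1}` is strictly contained in the set at which the branch is cut. Combining edges does not
  disturb this, because an edge of weight `Y_C ^ 2` never has the weight of an edge of another kind.
* If `Y_C ^ 2` is a product of variables `Y_I` with `I ∈ 𝓘`, then `C ∈ 𝓘`. Indeed `Y_I` has degree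
  `1` in `A_s` for `s ∈ I` and degree `0` for the other vertices, so that comparing degrees shows
  that `C` is a union of members of `𝓘` (`exists_union_of_clusterVar_sq_mem`), and a connected union
  of members of a nested collection is a member (`IsNested.mem_of_union`).

If `S ∈ 𝓘`, the rooted portion is empty and the only weight is `Y_S`. -/

namespace GraphLP

/-! ### Connected sets and paths in a tree -/

section Tree

variable {V : Type*} {Γ : SimpleGraph V}

/-- A connected set that meets a set `P` is contained in it if no edge inside it leaves `P`. -/
theorem IsConn.subset_of_closed {D P : Set V} (hD : IsConn Γ D) {x : V} (hx : x ∈ D)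
    (hxP : x ∈ P) (h : ∀ y ∈ D, y ∈ P → ∀ z ∈ D, Γ.Adj y z → z ∈ P) : D ⊆ P := by
  intro y hy
  obtain ⟨w⟩ := hD.preconnected ⟨x, hx⟩ ⟨y, hy⟩
  have key : ∀ (s t : D), (Γ.induce D).Walk s t → (s : V) ∈ P → (t : V) ∈ P := by
    intro s t w
    induction w with
    | nil => exact id
    | cons hadj _ ih => exact fun hs => ih (h _ (Subtype.prop _) hs _ (Subtype.prop _) hadj)
  exact key _ _ w hxP

theorem IsConn.union_of_adj {D E : Set V} (hD : IsConn Γ D) (hE : IsConn Γ E) {x y : V}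
    (hx : x ∈ D) (hy : y ∈ E) (h : Γ.Adj x y) : IsConn Γ (D ∪ E) :=
  SimpleGraph.connected_induce_union hD.preconnected hE.preconnected hx hy h

theorem isConn_singleton (x : V) : IsConn Γ {x} := by
  refine (SimpleGraph.connected_iff _).2 ⟨?_, ⟨⟨x, rfl⟩⟩⟩
  rintro ⟨a, rfl⟩ ⟨b, rfl⟩
  exact SimpleGraph.Reachable.refl _

theorem IsConn.nonempty {D : Set V} (hD : IsConn Γ D) : D.Nonempty :=
  Set.nonempty_coe_sort.1 (SimpleGraph.Connected.nonempty hD)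

theorem IsConn.exists_isPath {D : Set V} (hD : IsConn Γ D) {x y : V} (hx : x ∈ D) (hy : y ∈ D) :
    ∃ p : Γ.Walk x y, p.IsPath ∧ ∀ z ∈ p.support, z ∈ D := by
  obtain ⟨q, hq⟩ := SimpleGraph.Connected.exists_isPath hD ⟨x, hx⟩ ⟨y, hy⟩
  refine ⟨q.map (SimpleGraph.Embedding.induce D).toHom,
    hq.map Subtype.val_injective, ?_⟩
  intro z hz
  change z ∈ (q.map (SimpleGraph.Embedding.induce D).toHom).support at hz
  rw [SimpleGraph.Walk.support_map, List.mem_map] at hz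
  obtain ⟨a, -, rfl⟩ := hz
  exact a.2

theorem mem_pathSet_iff (hΓ : Γ.IsTree) {x y z : V} {p : Γ.Walk x y} (hp : p.IsPath) :
    z ∈ pathSet Γ x y ↔ z ∈ p.support := by
  refine ⟨?_, fun h => ⟨p, hp, h⟩⟩
  rintro ⟨q, hq, hz⟩
  rwa [(hΓ.existsUnique_path x y).unique hp hq]

theorem pathSet_comm (x y : V) : pathSet Γ x y = pathSet Γ y x := by
  have h : ∀ x y : V, pathSet Γ x y ⊆ pathSet Γ y x := by
    rintro x y z ⟨p, hp, hz⟩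
    exact ⟨p.reverse, hp.reverse, by simpa using hz⟩
  exact (h x y).antisymm (h y x)

theorem left_mem_pathSet (hΓ : Γ.IsTree) (x y : V) : x ∈ pathSet Γ x y := by
  obtain ⟨p, hp, -⟩ := hΓ.existsUnique_path x y
  exact ⟨p, hp, p.start_mem_support⟩

theorem right_mem_pathSet (hΓ : Γ.IsTree) (x y : V) : y ∈ pathSet Γ x y := by
  obtain ⟨p, hp, -⟩ := hΓ.existsUnique_path x y
  exact ⟨p, hp, p.end_mem_support⟩

theorem eq_of_mem_pathSet_self {x y : V} (h : y ∈ pathSet Γ x x) : y = x := by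
  obtain ⟨p, hp, hy⟩ := h
  cases p with
  | nil => simpa using hy
  | cons hadj p =>
    rw [SimpleGraph.Walk.cons_isPath_iff] at hp
    exact absurd p.end_mem_support hp.2

open Classical in
theorem mem_pathSet_trans (hΓ : Γ.IsTree) {v b c u : V} (hc : c ∈ pathSet Γ v b)
    (hb : b ∈ pathSet Γ v u) : c ∈ pathSet Γ v u := by
  obtain ⟨p, hp, hbp⟩ := hb
  rw [mem_pathSet_iff hΓ (hp.takeUntil hbp)] at hc
  exact ⟨p, hp, p.support_takeUntil_subset_support hbp hc⟩

open Classical in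
theorem mem_pathSet_snoc (hΓ : Γ.IsTree) {v u x b c : V} (hx : x ∈ pathSet Γ v u)
    (hxb : Γ.Adj x b) (hb : b ∉ pathSet Γ v u) (hc : c ∈ pathSet Γ v b) :
    c = b ∨ c ∈ pathSet Γ v u := by
  obtain ⟨p, hp, hxp⟩ := hx
  rw [mem_pathSet_iff hΓ hp] at hb ⊢
  have hsub := p.support_takeUntil_subset_support hxp
  have hq : ((p.takeUntil x hxp).concat hxb).IsPath :=
    (hp.takeUntil hxp).concat (fun h => hb (hsub h)) hxb
  rw [mem_pathSet_iff hΓ hq, SimpleGraph.Walk.support_concat] at hc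
  simp only [List.mem_append, List.mem_singleton] at hc
  exact hc.symm.imp id (fun h => hsub h)

open Classical in
/-- A path leaves its start through one neighbour only. -/
theorem eq_of_adj_of_mem_pathSet (hΓ : Γ.IsTree) {v t a a' : V} (ha : Γ.Adj v a)
    (ha' : Γ.Adj v a') (h : a ∈ pathSet Γ v t) (h' : a' ∈ pathSet Γ v t) : a = a' := by
  obtain ⟨p, hp, hap⟩ := h
  rw [mem_pathSet_iff hΓ hp] at h'
  have key : ∀ b, Γ.Adj v b → b ∈ p.support → p.snd = b := by
    intro b hb hbp
    have h1 : p.takeUntil b hbp = SimpleGraph.Walk.cons hb SimpleGraph.Walk.nil := by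
      refine (hΓ.existsUnique_path v b).unique (hp.takeUntil hbp) ?_
      simp [SimpleGraph.Walk.cons_isPath_iff, hb.ne]
    have h2 := p.take_spec hbp
    rw [h1] at h2
    rw [← h2]
    simp [SimpleGraph.Walk.snd]
  rw [← key a ha hap, key a' ha' h']

/-- A connected set that avoids `v` lies beyond any of its vertices adjacent to `v`. -/
theorem IsConn.mem_pathSet {D : Set V} (hD : IsConn Γ D) {v a c : V}
    (hv : v ∉ D) (hva : Γ.Adj v a) (ha : a ∈ D) (hc : c ∈ D) : a ∈ pathSet Γ v c := by
  obtain ⟨p, hp, hpD⟩ := hD.exists_isPath ha hc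
  refine ⟨.cons hva p, ?_, by simp⟩
  rw [SimpleGraph.Walk.cons_isPath_iff]
  exact ⟨hp, fun h => hv (hpD _ h)⟩

theorem IsConn.eq_of_adj (hΓ : Γ.IsTree) {D : Set V} (hD : IsConn Γ D) {v a a' : V}
    (hv : v ∉ D) (hva : Γ.Adj v a) (hva' : Γ.Adj v a') (ha : a ∈ D) (ha' : a' ∈ D) : a = a' :=
  eq_of_adj_of_mem_pathSet hΓ hva hva' (hD.mem_pathSet hv hva ha ha')
    (right_mem_pathSet hΓ v a')

theorem exists_adj_mem_pathSet (hΓ : Γ.IsTree) {v t : V} (h : t ≠ v) :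
    ∃ a, Γ.Adj v a ∧ a ∈ pathSet Γ v t := by
  obtain ⟨p, hp, -⟩ := hΓ.existsUnique_path v t
  cases p with
  | nil => exact absurd rfl h
  | cons hadj q => exact ⟨_, hadj, _, hp, by simp⟩

/-- Every path from `v` to another vertex can be prolonged to a leaf. -/
theorem exists_isLeaf_beyond [Finite V] (hΓ : Γ.IsTree) {v c : V} (hc : c ≠ v) :
    ∃ t, IsLeaf Γ t ∧ c ∈ pathSet Γ v t := by
  obtain ⟨t, ht⟩ := (Set.toFinite {t | c ∈ pathSet Γ v t}).exists_maximalFor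
    (fun t => pathSet Γ v t) _ ⟨c, right_mem_pathSet hΓ v c⟩
  have hct : c ∈ pathSet Γ v t := ht.1
  refine ⟨t, ?_, hct⟩
  have htv : v ≠ t := by
    rintro rfl
    exact hc (eq_of_mem_pathSet_self hct)
  have hin : ∀ s, Γ.Adj t s → s ∈ pathSet Γ v t := by
    intro s hs
    by_contra hst
    obtain ⟨p, hp, -⟩ := hΓ.existsUnique_path v t
    have hsp := hst
    rw [mem_pathSet_iff hΓ hp] at hsp
    have hq : (p.concat hs).IsPath := hp.concat hsp hs
    have hle : pathSet Γ v t ⊆ pathSet Γ v s := by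
      intro z hz
      rw [mem_pathSet_iff hΓ hp] at hz
      rw [mem_pathSet_iff hΓ hq, SimpleGraph.Walk.support_concat]
      simp [hz]
    exact hst (ht.2 (hle hct) hle (right_mem_pathSet hΓ v s))
  obtain ⟨s, hts, -⟩ := exists_adj_mem_pathSet hΓ htv
  unfold IsLeaf
  rw [Set.ncard_eq_one]
  refine ⟨s, Set.eq_singleton_iff_unique_mem.2 ⟨hts, fun s' hs' => ?_⟩⟩
  have hs := hin s hts
  have hs'' := hin s' hs'
  rw [pathSet_comm] at hs hs''
  exact eq_of_adj_of_mem_pathSet hΓ hs' hts hs'' hs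

/-- A path that runs through `c ∈ C` and ends outside `C` leaves `C` after `c` along an edge
`y b`. -/
theorem exists_exit {v t c : V} {C : Set V} (hct : c ∈ pathSet Γ v t)
    (hc : c ∈ C) (ht : t ∉ C) :
    ∃ y ∈ C, ∃ b, b ∉ C ∧ Γ.Adj y b ∧ c ∈ pathSet Γ v b ∧ b ∈ pathSet Γ v t := by
  obtain ⟨p, hp, hcp⟩ := hct
  have key : ∀ (y : V) (q : Γ.Walk y t) (r : Γ.Walk v y), (r.append q).IsPath → y ∈ C →
      c ∈ r.support →
      ∃ y ∈ C, ∃ b, b ∉ C ∧ Γ.Adj y b ∧ c ∈ pathSet Γ v b ∧ b ∈ pathSet Γ v t := by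
    intro y q
    induction q with
    | nil => exact fun _ _ hy _ => absurd hy ht
    | @cons y b t hadj q ih =>
      intro r hr hy hcr
      rw [← SimpleGraph.Walk.concat_append] at hr
      have hcr' : c ∈ (r.concat hadj).support := by
        rw [SimpleGraph.Walk.support_concat]
        simp [hcr]
      by_cases hb : b ∈ C
      · exact ih ht p hp hcp (r.concat hadj) hr hb hcr'
      · refine ⟨y, hy, b, hb, hadj, ⟨_, hr.of_append_left, hcr'⟩, ⟨_, hr, ?_⟩⟩
        rw [SimpleGraph.Walk.mem_support_append_iff]
        exact Or.inr q.start_mem_support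
  classical
  refine key c (p.dropUntil c hcp) (p.takeUntil c hcp) ?_ hc (by simp)
  rwa [p.take_spec hcp]

/-- Paths from `v` that start towards different neighbours have only `v` in common. -/
theorem eq_of_mem_pathSet_of_mem_pathSet (hΓ : Γ.IsTree) {v a t t' z : V} (hva : Γ.Adj v a)
    (hat : a ∈ pathSet Γ v t) (hat' : a ∉ pathSet Γ v t') (hz : z ∈ pathSet Γ v t)
    (hz' : z ∈ pathSet Γ v t') : z = v := by
  by_contra hne
  obtain ⟨n, hvn, hn⟩ := exists_adj_mem_pathSet hΓ hne
  have hna := eq_of_adj_of_mem_pathSet hΓ hvn hva (mem_pathSet_trans hΓ hn hz) hat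
  exact hat' (hna ▸ mem_pathSet_trans hΓ hn hz')

end Tree

/-! ### Paths in the extended tree -/

section Extended

variable {V : Type*} {Γ : SimpleGraph V}

/-- The inclusion of `Γ` into the extended tree. -/
def extEmb (Γ : SimpleGraph V) : Γ ↪g extGraph Γ where
  toFun := Sum.inl
  inj' := Sum.inl_injective
  map_rel_iff' := Iff.rfl

/-- A path in the extended tree from an old vertex to the new vertex at a leaf `t` meets `Γ` in
the path to `t`. -/
theorem mem_pathSet_of_ext {x z : V} {t : {l : V // IsLeaf Γ l}}
    (h : Sum.inl z ∈ pathSet (extGraph Γ) (.inl x) (.inr t)) : z ∈ pathSet Γ x t := by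
  have key : ∀ (a b : ExtVertex Γ) (p : (extGraph Γ).Walk a b), p.IsPath → ∀ x : V, a = .inl x →
      b = .inr t → ∃ q : Γ.Walk x t, q.IsPath ∧ ∀ z, z ∈ q.support ↔ Sum.inl z ∈ p.support := by
    intro a b p
    induction p with
    | nil =>
      rintro - x rfl h
      cases h
    | @cons a a' b hadj p ih =>
      rintro hp x rfl rfl
      rw [SimpleGraph.Walk.cons_isPath_iff] at hp
      rcases a' with x' | s
      · obtain ⟨q, hq, hqs⟩ := ih hp.1 x' rfl rfl
        have hadj' : Γ.Adj x x' := hadj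
        refine ⟨.cons hadj' q, ?_, fun z => ?_⟩
        · rw [SimpleGraph.Walk.cons_isPath_iff, hqs]
          exact ⟨hq, hp.2⟩
        · simp [hqs]
      · have hxs : x = s := hadj
        cases p with
        | nil =>
          subst hxs
          exact ⟨.nil, by simp, fun z => by simp⟩
        | @cons _ w _ hadj' p =>
          -- The new vertex `s` has no neighbour but `x`, to which a path cannot return.
          rcases w with w | w
          · have hws : w = x := (show w = s from hadj').trans hxs.symm
            subst hws
            exact absurd (by simp) hp.2
          · exact hadj'.elim
  obtain ⟨p, hp, hz⟩ := h
  obtain ⟨q, hq, hqs⟩ := key _ _ p hp x rfl rfl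
  exact ⟨q, hq, (hqs z).2 hz⟩

theorem exists_ext_isPath (hΓ : Γ.IsTree) (x : V) (t : {l : V // IsLeaf Γ l}) :
    ∃ p : (extGraph Γ).Walk (.inl x) (.inr t), p.IsPath ∧
      ∀ z, z ∈ p.support ↔ z = .inr t ∨ ∃ y ∈ pathSet Γ x t, z = .inl y := by
  obtain ⟨q, hq, -⟩ := hΓ.existsUnique_path x t
  obtain ⟨r, hr, hs⟩ : ∃ r : (extGraph Γ).Walk (.inl x) (.inl t.1), r.IsPath ∧
      ∀ z, z ∈ r.support ↔ ∃ y ∈ pathSet Γ x t, z = .inl y := by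
    refine ⟨q.map (extEmb Γ).toHom, hq.map (extEmb Γ).injective, fun z => ?_⟩
    change z ∈ (q.map (extEmb Γ).toHom).support ↔ _
    rw [SimpleGraph.Walk.support_map, List.mem_map]
    constructor
    · rintro ⟨y, hy, rfl⟩
      exact ⟨y, ⟨q, hq, hy⟩, rfl⟩
    · rintro ⟨y, hy, rfl⟩
      exact ⟨y, (mem_pathSet_iff hΓ hq).1 hy, rfl⟩
  have hadj : (extGraph Γ).Adj (.inl t.1) (.inr t) := rfl
  refine ⟨r.concat hadj, hr.concat ?_ hadj, fun z => ?_⟩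
  · rw [hs]
    rintro ⟨y, -, h⟩
    cases h
  · rw [SimpleGraph.Walk.support_concat, List.mem_append, hs, List.mem_singleton, or_comm]

/-- If the paths from `x` to the leaves `s` and `t` have only `x` in common, then the path between
the new vertices at `s` and `t` runs through both. -/
theorem mem_ext_pathSet (hΓ : Γ.IsTree) {x : V} {s t : {l : V // IsLeaf Γ l}} (hst : s ≠ t)
    (h : ∀ z, z ∈ pathSet Γ x s → z ∈ pathSet Γ x t → z = x) {z : ExtVertex Γ}
    (hz : z = .inr s ∨ z = .inr t ∨ ∃ y, z = .inl y ∧ (y ∈ pathSet Γ x s ∨ y ∈ pathSet Γ x t)) :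
    z ∈ pathSet (extGraph Γ) (.inr s) (.inr t) := by
  obtain ⟨p, hp, hps⟩ := exists_ext_isPath hΓ x s
  obtain ⟨q, hq, hqs⟩ := exists_ext_isPath hΓ x t
  refine ⟨p.reverse.append q, ?_, ?_⟩
  · refine SimpleGraph.Walk.IsPath.mk' ?_
    rw [SimpleGraph.Walk.support_append, List.nodup_append']
    refine ⟨hp.reverse.support_nodup, hq.support_nodup.sublist q.support.tail_sublist, ?_⟩
    intro z hz1 hz2
    have hzx : z ≠ .inl x := by
      rintro rfl
      have h3 := hq.support_nodup
      rw [← SimpleGraph.Walk.cons_tail_support, List.nodup_cons] at h3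
      exact h3.1 hz2
    have hz1' : z ∈ p.support := by simpa using hz1
    have hz2' := List.mem_of_mem_tail hz2
    rw [hps] at hz1'
    rw [hqs] at hz2'
    rcases hz1' with rfl | ⟨y, hy, rfl⟩
    · rcases hz2' with h | ⟨y, -, h⟩
      · exact hst (Sum.inr_injective h)
      · cases h
    · rcases hz2' with h' | ⟨y', hy', h'⟩
      · cases h'
      · cases h'
        exact hzx (congrArg _ (h y hy hy'))
  · rw [SimpleGraph.Walk.mem_support_append_iff, SimpleGraph.Walk.support_reverse,
      List.mem_reverse, hps, hqs]
    rcases hz with h | h | ⟨y, rfl, h | h⟩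
    · exact Or.inl (Or.inl h)
    · exact Or.inr (Or.inl h)
    · exact Or.inl (Or.inr ⟨y, h, rfl⟩)
    · exact Or.inr (Or.inr ⟨y, h, rfl⟩)

/-- The new vertices are leaves of the extended tree. -/
theorem isLeaf_ext (t : {l : V // IsLeaf Γ l}) : IsLeaf (extGraph Γ) (.inr t) := by
  unfold IsLeaf
  rw [Set.ncard_eq_one]
  refine ⟨.inl t.1, Set.eq_singleton_iff_unique_mem.2 ⟨rfl, ?_⟩⟩
  rintro (y | y) hy
  · exact congrArg _ (show y = t from hy)
  · exact hy.elim

end Extended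

/-! ### Nested collections -/

section Nested

variable {V : Type*} {Γ : SimpleGraph V}

theorem IsComponent.conn {T : Set V} {C : Finset V} (hC : IsComponent Γ T C) :
    IsConn Γ (C : Set V) := hC.1.2

theorem IsComponent.subset {T : Set V} {C : Finset V} (hC : IsComponent Γ T C) :
    (C : Set V) ⊆ T := hC.1.1

/-- A component absorbs every connected subset that meets it or is joined to it by an edge. -/
theorem IsComponent.subset_of_adj {T : Set V} {C D : Finset V} (hC : IsComponent Γ T C)
    (hD : IsConn Γ (D : Set V)) (hDT : (D : Set V) ⊆ T) {x y : V} (hx : x ∈ C) (hy : y ∈ D)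
    (h : x = y ∨ Γ.Adj x y) : D ⊆ C := by
  classical
  have hconn : IsConn Γ ((C ∪ D : Finset V) : Set V) := by
    rw [Finset.coe_union]
    rcases h with rfl | h
    · exact SimpleGraph.induce_union_connected hC.conn.preconnected hD.preconnected
        ⟨x, hx, hy⟩
    · exact hC.conn.union_of_adj hD hx hy h
  have hle : C ∪ D ⊆ C := hC.2
    ⟨by rw [Finset.coe_union]; exact Set.union_subset hC.subset hDT, hconn⟩ Finset.subset_union_left
  exact Finset.subset_union_right.trans hle

theorem IsComponent.mem_of_adj {T : Set V} {C : Finset V} (hC : IsComponent Γ T C)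
    {x y : V} (hx : x ∈ C) (hy : y ∈ T) (h : Γ.Adj x y) : y ∈ C := by
  have hD : IsConn Γ (({y} : Finset V) : Set V) := by
    rw [Finset.coe_singleton]
    exact isConn_singleton y
  exact hC.subset_of_adj hD (by simpa using hy) hx (Finset.mem_singleton_self y) (Or.inr h)
    (Finset.mem_singleton_self y)

theorem exists_isComponent [Finite V] {T : Set V} {x : V} (hx : x ∈ T) :
    ∃ C : Finset V, IsComponent Γ T C ∧ x ∈ C := by
  obtain ⟨C, hxC, hC⟩ := (Set.toFinite
    {D : Finset V | (D : Set V) ⊆ T ∧ IsConn Γ (D : Set V)}).exists_le_maximal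
    (a := {x}) ⟨by simpa using hx, by rw [Finset.coe_singleton]; exact isConn_singleton x⟩
  exact ⟨C, hC, hxC (Finset.mem_singleton_self x)⟩

theorem IsNested.not_adj {𝓙 : Set (Finset V)} (h : IsNested Γ 𝓙) {J K : Finset V} (hJ : J ∈ 𝓙)
    (hK : K ∈ 𝓙) (hd : Disjoint J K) {x y : V} (hx : x ∈ J) (hy : y ∈ K) : ¬ Γ.Adj x y := by
  intro hxy
  have hJK : ({J, K} : Set (Finset V)) ⊆ 𝓙 := Set.insert_subset hJ (Set.singleton_subset_iff.2 hK)
  have hp : ({J, K} : Set (Finset V)).PairwiseDisjoint id := by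
    rw [Set.PairwiseDisjoint, Set.pairwise_pair]
    exact fun _ => ⟨hd, hd.symm⟩
  have hC := (h.components _ hJK hp J).2 (Set.mem_insert _ _)
  have hKJ : K ⊆ J := by
    refine hC.subset_of_adj (h.conn K hK) ?_ hx hy (Or.inr hxy)
    exact Set.subset_biUnion_of_mem (u := fun J : Finset V => (J : Set V)) (by simp)
  exact Finset.disjoint_left.1 hd (hKJ hy) hy

theorem IsNested.subset_or_subset {𝓙 : Set (Finset V)} (h : IsNested Γ 𝓙) {J K : Finset V}
    (hJ : J ∈ 𝓙) (hK : K ∈ 𝓙) {x y : V} (hx : x ∈ J) (hy : y ∈ K) (hxy : x = y ∨ Γ.Adj x y) :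
    J ⊆ K ∨ K ⊆ J := by
  rcases h.laminar J hJ K hK with h' | h' | hd
  · exact Or.inl h'
  · exact Or.inr h'
  · rcases hxy with rfl | hxy
    · exact absurd hy (Finset.disjoint_left.1 hd hx)
    · exact absurd hxy (h.not_adj hJ hK hd hx hy)

/-- A family of connected sets is nested as soon as any two of its members are comparable, or
disjoint without an edge between them. -/
theorem isNested_of_separated {𝓙 : Set (Finset V)} (hconn : ∀ J ∈ 𝓙, IsConn Γ (J : Set V))
    (h : ∀ J ∈ 𝓙, ∀ K ∈ 𝓙, J ⊆ K ∨ K ⊆ J ∨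
      (Disjoint J K ∧ ∀ x ∈ J, ∀ y ∈ K, ¬ Γ.Adj x y)) : IsNested Γ 𝓙 := by
  refine ⟨hconn, fun J hJ K hK => (h J hJ K hK).imp_right (Or.imp_right And.left), ?_⟩
  intro 𝓚 h𝓚 hp C
  have hclosed : ∀ J ∈ 𝓚, ∀ D : Set V, IsConn Γ D → D ⊆ ⋃ J ∈ 𝓚, (J : Set V) →
      ∀ x ∈ D, x ∈ J → D ⊆ J := by
    intro J hJ D hD hDU x hxD hxJ
    refine hD.subset_of_closed hxD hxJ ?_
    intro y hy hyJ z hz hyz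
    obtain ⟨K, hK, hzK⟩ := Set.mem_iUnion₂.1 (hDU hz)
    by_cases hJK : J = K
    · exact hJK ▸ hzK
    · have hd : Disjoint J K := hp hJ hK hJK
      rcases h J (h𝓚 hJ) K (h𝓚 hK) with h' | h' | h'
      · exact absurd (h' hyJ) (Finset.disjoint_left.1 hd hyJ)
      · exact h' hzK
      · exact absurd hyz (h'.2 y hyJ z hzK)
  have hU : ∀ J ∈ 𝓚, (J : Set V) ⊆ ⋃ J ∈ 𝓚, (J : Set V) := fun J hJ =>
    Set.subset_biUnion_of_mem (u := fun J : Finset V => (J : Set V)) hJ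
  constructor
  · intro hC
    obtain ⟨x, hx⟩ := hC.conn.nonempty
    obtain ⟨J, hJ, hxJ⟩ := Set.mem_iUnion₂.1 (hC.subset hx)
    have hCJ : C ⊆ J := hclosed J hJ C hC.conn hC.subset x hx hxJ
    have hJC : J ⊆ C := hC.subset_of_adj (hconn J (h𝓚 hJ)) (hU J hJ) hx hxJ (Or.inl rfl)
    rwa [hCJ.antisymm hJC]
  · intro hC
    refine ⟨⟨hU C hC, hconn C (h𝓚 hC)⟩, ?_⟩
    intro D hD hCD
    obtain ⟨x, hx⟩ := (hconn C (h𝓚 hC)).nonempty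
    exact hclosed C hC D hD.2 hD.1 x (hCD hx) hx

/-- A connected set that is a union of members of a nested collection is itself a member. -/
theorem IsNested.mem_of_union [Finite V] {𝓙 : Set (Finset V)} (h : IsNested Γ 𝓙) {C : Finset V}
    (hC : IsConn Γ (C : Set V)) (hU : ∀ x ∈ C, ∃ J ∈ 𝓙, x ∈ J ∧ J ⊆ C) : C ∈ 𝓙 := by
  obtain ⟨c, hc⟩ := hC.nonempty
  obtain ⟨J₀, hJ₀, hcJ₀, hJ₀C⟩ := hU c hc
  obtain ⟨J, hle, hJ⟩ := (Set.toFinite {J : Finset V | J ∈ 𝓙 ∧ J ⊆ C}).exists_le_maximal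
    (a := J₀) ⟨hJ₀, hJ₀C⟩
  have hCJ : (C : Set V) ⊆ J := by
    refine hC.subset_of_closed hc (hle hcJ₀) ?_
    intro y _ hyJ z hz hyz
    obtain ⟨K, hK, hzK, hKC⟩ := hU z hz
    rcases h.subset_or_subset hJ.1.1 hK hyJ hzK (Or.inr hyz) with h' | h'
    · exact hJ.2 ⟨hK, hKC⟩ h' hzK
    · exact h' hzK
  have : C = J := Finset.Subset.antisymm hCJ hJ.1.2
  exact this ▸ hJ.1.1

variable [Fintype V] {𝓘 : Finset (Finset V)}

theorem self_mem_minSet (v : V) : v ∈ minSet 𝓘 v := by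
  simp [minSet]

theorem minSet_subset {v : V} {I : Finset V} (hI : I ∈ 𝓘) (hv : v ∈ I) : minSet 𝓘 v ⊆ I := by
  intro x hx
  simp only [minSet, Finset.mem_filter] at hx
  exact hx.2 I hI hv

theorem IsMaxNested.minSet_mem (h : IsMaxNested Γ 𝓘) (v : V) : minSet 𝓘 v ∈ 𝓘 := by
  obtain ⟨I₀, hI₀, hv₀⟩ := h.cover v
  obtain ⟨I, -, hI⟩ := (Set.toFinite {I : Finset V | I ∈ 𝓘 ∧ v ∈ I}).exists_le_minimal
    (a := I₀) ⟨hI₀, hv₀⟩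
  have hIm : minSet 𝓘 v = I := by
    refine (minSet_subset hI.1.1 hI.1.2).antisymm fun x hx => ?_
    simp only [minSet, Finset.mem_filter, Finset.mem_univ, true_and]
    intro J hJ hvJ
    rcases h.nested.subset_or_subset hI.1.1 hJ hI.1.2 hvJ (Or.inl rfl) with h' | h'
    · exact h' hx
    · exact hI.2 ⟨hJ, hvJ⟩ h' hx
  exact hIm ▸ hI.1.1

/-- By maximality, every member of a maximal nested collection has at most one vertex of which it
is the smallest member. -/
theorem IsMaxNested.eq_of_minSet_eq (h : IsMaxNested Γ 𝓘) {v w : V}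
    (hvw : minSet 𝓘 v = minSet 𝓘 w) : v = w := by
  by_contra hne
  -- Otherwise the component of `w` in `I_v ∖ {v}` could be added to the collection.
  obtain ⟨D, hD, hwD⟩ := exists_isComponent (Γ := Γ) (T := (minSet 𝓘 v : Set V) \ {v}) (x := w)
    ⟨by rw [hvw]; exact self_mem_minSet w, fun h => hne h.symm⟩
  have hvD : v ∉ D := fun hv => (hD.subset hv).2 rfl
  have hDv : D ⊆ minSet 𝓘 v := fun x hx => (hD.subset hx).1
  have hsep : ∀ J ∈ 𝓘, J ⊆ D ∨ D ⊆ J ∨ (Disjoint J D ∧ ∀ x ∈ J, ∀ y ∈ D, ¬ Γ.Adj x y) := by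
    intro J hJ
    rcases h.nested.laminar J hJ _ (h.minSet_mem v) with hJv | hvJ | hd
    · by_cases hv : v ∈ J
      · exact Or.inr (Or.inl (hDv.trans (minSet_subset hJ hv)))
      · have hJT : (J : Set V) ⊆ (minSet 𝓘 v : Set V) \ {v} := fun x hx =>
          ⟨hJv hx, fun hxv => hv (hxv ▸ hx)⟩
        by_cases hm : ∃ x ∈ D, ∃ y ∈ J, x = y ∨ Γ.Adj x y
        · obtain ⟨x, hx, y, hy, hxy⟩ := hm
          exact Or.inl (hD.subset_of_adj (h.nested.conn J hJ) hJT hx hy hxy)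
        · push Not at hm
          refine Or.inr (Or.inr ⟨Finset.disjoint_left.2 fun x hx hx' =>
            (hm x hx' x hx).1 rfl, fun x hx y hy hxy => (hm y hy x hx).2 hxy.symm⟩)
    · exact Or.inr (Or.inl (hDv.trans hvJ))
    · exact Or.inr (Or.inr ⟨hd.mono_right hDv, fun x hx y hy =>
        h.nested.not_adj hJ (h.minSet_mem v) hd hx (hDv hy)⟩)
  have hDI : D ∈ 𝓘 := by
    refine h.maximal D (isNested_of_separated ?_ ?_)
    · rintro J (rfl | hJ)
      · exact hD.conn
      · exact h.nested.conn J hJ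
    · rintro J (rfl | hJ) K (rfl | hK)
      · exact Or.inl subset_rfl
      · rcases hsep K hK with h' | h' | h'
        · exact Or.inr (Or.inl h')
        · exact Or.inl h'
        · exact Or.inr (Or.inr ⟨h'.1.symm, fun x hx y hy hxy => h'.2 y hy x hx hxy.symm⟩)
      · exact hsep J hJ
      · refine (h.nested.laminar J hJ K hK).imp_right (Or.imp_right fun hd => ⟨hd, ?_⟩)
        exact fun x hx y hy => h.nested.not_adj hJ hK hd hx hy
  exact hvD (minSet_subset hDI hwD (hvw ▸ self_mem_minSet v))

end Nested

/-! ### The chain of members on a branch -/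

section Branch

variable {V : Type*} {Γ : SimpleGraph V} {𝓘 : Finset (Finset V)} {v a : V}

theorem mem_branchSets {I : Finset V} : I ∈ branchSets 𝓘 v a ↔ I ∈ 𝓘 ∧ a ∈ I ∧ v ∉ I := by
  simp [branchSets]

theorem branchSets_chain (h : IsNested Γ (𝓘 : Set (Finset V))) {J K : Finset V}
    (hJ : J ∈ branchSets 𝓘 v a) (hK : K ∈ branchSets 𝓘 v a) : J ⊆ K ∨ K ⊆ J := by
  rw [mem_branchSets] at hJ hK
  exact h.subset_or_subset hJ.1 hK.1 hJ.2.1 hK.2.1 (Or.inl rfl)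

open Classical in
/-- The rank of a member of a branch: the number of members of the branch that contain it. -/
noncomputable def branchRank (𝓘 : Finset (Finset V)) (v a : V) (J : Finset V) : ℕ :=
  ((branchSets 𝓘 v a).filter (fun K => J ⊆ K)).card

open Classical in
theorem branchRank_lt {J K : Finset V} (hJ : J ∈ branchSets 𝓘 v a) (hJK : J ⊂ K) :
    branchRank 𝓘 v a K < branchRank 𝓘 v a J := by
  refine Finset.card_lt_card (Finset.ssubset_iff_of_subset ?_ |>.2 ⟨J, ?_, ?_⟩)
  · intro L hL
    rw [Finset.mem_filter] at hL ⊢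
    exact ⟨hL.1, hJK.subset.trans hL.2⟩
  · exact Finset.mem_filter.2 ⟨hJ, subset_rfl⟩
  · exact fun h => hJK.not_subset (Finset.mem_filter.1 h).2

theorem branchRank_injOn (h : IsNested Γ (𝓘 : Set (Finset V))) :
    Set.InjOn (branchRank 𝓘 v a) (branchSets 𝓘 v a) := by
  intro J hJ K hK hJK
  by_contra hne
  rcases branchSets_chain h hJ hK with h' | h'
  · exact (branchRank_lt hJ (h'.ssubset_of_ne hne)).ne' hJK
  · exact (branchRank_lt hK (h'.ssubset_of_ne (Ne.symm hne))).ne hJK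

open Classical in
theorem image_branchRank (h : IsNested Γ (𝓘 : Set (Finset V))) :
    (branchSets 𝓘 v a).image (branchRank 𝓘 v a) = Finset.Icc 1 (branchLen 𝓘 v a) := by
  refine Finset.eq_of_subset_of_card_le ?_ ?_
  · intro n hn
    obtain ⟨J, hJ, rfl⟩ := Finset.mem_image.1 hn
    rw [Finset.mem_Icc]
    exact ⟨Finset.card_pos.2 ⟨J, Finset.mem_filter.2 ⟨hJ, subset_rfl⟩⟩,
      Finset.card_le_card (Finset.filter_subset _ _)⟩
  · rw [Finset.card_image_of_injOn (branchRank_injOn h), Nat.card_Icc, Nat.add_sub_cancel,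
      branchLen]

variable [Fintype V]

theorem branchSet_branchRank (h : IsNested Γ (𝓘 : Set (Finset V))) {J : Finset V}
    (hJ : J ∈ branchSets 𝓘 v a) : branchSet 𝓘 v a (branchRank 𝓘 v a J) = J := by
  ext x
  simp only [branchSet, Finset.mem_filter, Finset.mem_univ, true_and]
  constructor
  · rintro ⟨K, hK, hKJ, hx⟩
    rwa [← branchRank_injOn h hK hJ hKJ]
  · exact fun hx => ⟨J, hJ, rfl, hx⟩

theorem exists_eq_branchSet (h : IsNested Γ (𝓘 : Set (Finset V))) {J : Finset V}
    (hJ : J ∈ branchSets 𝓘 v a) : ∃ j, 1 ≤ j ∧ j ≤ branchLen 𝓘 v a ∧ J = branchSet 𝓘 v a j := by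
  have hm := Finset.mem_image_of_mem (branchRank 𝓘 v a) hJ
  rw [image_branchRank h, Finset.mem_Icc] at hm
  exact ⟨_, hm.1, hm.2, (branchSet_branchRank h hJ).symm⟩

theorem branchSet_mem_and_rank (h : IsNested Γ (𝓘 : Set (Finset V))) {j : ℕ} (hj : 1 ≤ j)
    (hjc : j ≤ branchLen 𝓘 v a) :
    branchSet 𝓘 v a j ∈ branchSets 𝓘 v a ∧ branchRank 𝓘 v a (branchSet 𝓘 v a j) = j := by
  have hm : j ∈ (branchSets 𝓘 v a).image (branchRank 𝓘 v a) := by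
    rw [image_branchRank h]
    exact Finset.mem_Icc.2 ⟨hj, hjc⟩
  obtain ⟨J, hJ, rfl⟩ := Finset.mem_image.1 hm
  rw [branchSet_branchRank h hJ]
  exact ⟨hJ, rfl⟩

theorem branchSet_mem (h : IsNested Γ (𝓘 : Set (Finset V))) {j : ℕ} (hj : 1 ≤ j)
    (hjc : j ≤ branchLen 𝓘 v a) : branchSet 𝓘 v a j ∈ branchSets 𝓘 v a :=
  (branchSet_mem_and_rank h hj hjc).1

theorem branchSet_ssubset_iff (h : IsNested Γ (𝓘 : Set (Finset V))) {i j : ℕ} (hi : 1 ≤ i)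
    (hic : i ≤ branchLen 𝓘 v a) (hj : 1 ≤ j) (hjc : j ≤ branchLen 𝓘 v a) :
    branchSet 𝓘 v a i ⊂ branchSet 𝓘 v a j ↔ j < i := by
  obtain ⟨hmi, hri⟩ := branchSet_mem_and_rank h hi hic
  obtain ⟨hmj, hrj⟩ := branchSet_mem_and_rank h hj hjc
  constructor
  · intro hlt
    have := branchRank_lt hmi hlt
    omega
  · intro hlt
    rcases branchSets_chain h hmi hmj with h' | h'
    · exact h'.ssubset_of_ne fun he => by rw [he] at hri; omega
    · rcases h'.eq_or_ssubset with he | hs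
      · rw [he] at hrj
        omega
      · have := branchRank_lt hmj hs
        omega

theorem branchSet_subset (h : IsNested Γ (𝓘 : Set (Finset V))) {i j : ℕ} (hj : 1 ≤ j)
    (hji : j ≤ i) (hic : i ≤ branchLen 𝓘 v a) : branchSet 𝓘 v a i ⊆ branchSet 𝓘 v a j := by
  rcases hji.eq_or_lt with rfl | hlt
  · exact subset_rfl
  · exact ((branchSet_ssubset_iff h (hj.trans hji) hic hj (hji.trans hic)).2 hlt).subset

theorem IsLower.one_le_branchLen (h : IsMaxNested Γ 𝓘) (ha : IsLower Γ 𝓘 v a) :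
    1 ≤ branchLen 𝓘 v a := by
  refine Finset.card_pos.2 ⟨minSet 𝓘 a, mem_branchSets.2
    ⟨h.minSet_mem a, self_mem_minSet a, fun hv => ha.1.ne ?_⟩⟩
  exact h.eq_of_minSet_eq ((minSet_subset (h.minSet_mem a) hv).antisymm
    (minSet_subset (h.minSet_mem v) ha.2))

/-- If `u` is the largest vertex of `I_j`, then `I_{j+1}` is closed under adjacency in
`I_j ∖ {u}`. -/
theorem mem_branchSet_succ_of_adj (h : IsMaxNested Γ 𝓘) {j : ℕ} (hj : 1 ≤ j)
    (hjc : j < branchLen 𝓘 v a) {u : V} (hu : IsTop 𝓘 (branchSet 𝓘 v a j) u) {y w : V}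
    (hy : y ∈ branchSet 𝓘 v a (j + 1)) (hw : w ∈ branchSet 𝓘 v a j) (hwu : w ≠ u)
    (hyw : Γ.Adj y w) : w ∈ branchSet 𝓘 v a (j + 1) := by
  have hmj := mem_branchSets.1 (branchSet_mem h.nested hj hjc.le)
  have hmj' := mem_branchSets.1 (branchSet_mem h.nested (Nat.le_add_left 1 j) hjc)
  have hwj : minSet 𝓘 w ⊆ branchSet 𝓘 v a j := minSet_subset hmj.1 hw
  rcases h.nested.subset_or_subset hmj'.1 (h.minSet_mem w) hy (self_mem_minSet w)
    (Or.inr hyw) with h' | h'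
  · -- No member lies strictly between `I_{j+1}` and `I_j`, so that `I_w = I_{j+1}`.
    obtain ⟨n, hn, hnc, hwn⟩ := exists_eq_branchSet h.nested
      (mem_branchSets.2 ⟨h.minSet_mem w, h' hmj'.2.1, fun hv => hmj.2.2 (hwj hv)⟩)
    have hne : minSet 𝓘 w ≠ branchSet 𝓘 v a j := by
      intro he
      refine hwu (h.eq_of_minSet_eq ?_)
      refine (minSet_subset (h.minSet_mem u) (hu.2 w hw)).antisymm ?_
      rw [he]
      exact minSet_subset hmj.1 hu.1
    have hlt := hwj.ssubset_of_ne hne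
    rw [hwn, branchSet_ssubset_iff h.nested hn hnc hj hjc.le] at hlt
    have hw' := self_mem_minSet (𝓘 := 𝓘) w
    rw [hwn] at hw'
    exact branchSet_subset h.nested (Nat.le_add_left 1 j) hlt hnc hw'
  · exact h' (self_mem_minSet w)

end Branch

/-! ### Degrees in the coefficient variables -/

section Degree

open Classical in
/-- The specialisation `A_s ↦ T`, with all other variables sent to `1`. -/
noncomputable def specialize {V : Type*} (s : V) : MvPolynomial (V ⊕ V) ℤ →+* Polynomial ℤ :=
  MvPolynomial.eval₂Hom (Int.castRingHom _)
    (Sum.elim (fun w => if w = s then Polynomial.X else 1) fun _ => 1)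

variable {V : Type*} {s : V}

theorem specialize_X_inl_self : specialize s (MvPolynomial.X (.inl s)) = Polynomial.X := by
  simp [specialize]

theorem specialize_X_inl_of_ne {w : V} (h : w ≠ s) :
    specialize s (MvPolynomial.X (.inl w)) = 1 := by
  simp [specialize, h]

theorem specialize_X_inr (w : V) : specialize s (MvPolynomial.X (.inr w)) = 1 := by
  simp [specialize]

/-- The element `y` of the fraction field has a fraction whose numerator specialises to `P`
under `A_s ↦ T` and whose denominator specialises to `1`. -/
def SpecializesTo (s : V) (y : LPField V) (P : Polynomial ℤ) : Prop :=
  ∃ p q : MvPolynomial (V ⊕ V) ℤ, specialize s q = 1 ∧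
    y * algebraMap _ (LPField V) q = algebraMap _ (LPField V) p ∧ specialize s p = P

theorem SpecializesTo.unique {y : LPField V} {P P' : Polynomial ℤ} (h : SpecializesTo s y P)
    (h' : SpecializesTo s y P') : P = P' := by
  obtain ⟨p, q, hq, hy, rfl⟩ := h
  obtain ⟨p', q', hq', hy', rfl⟩ := h'
  have key : p * q' = p' * q := by
    apply IsFractionRing.injective (MvPolynomial (V ⊕ V) ℤ) (LPField V)
    rw [map_mul, map_mul, ← hy, ← hy']
    ring
  have := congrArg (specialize s) key
  simpa [hq, hq'] using this

theorem SpecializesTo.one : SpecializesTo s 1 1 := ⟨1, 1, by simp, by simp, by simp⟩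

theorem SpecializesTo.mul {y y' : LPField V} {P P' : Polynomial ℤ} (h : SpecializesTo s y P)
    (h' : SpecializesTo s y' P') : SpecializesTo s (y * y') (P * P') := by
  obtain ⟨p, q, hq, hy, rfl⟩ := h
  obtain ⟨p', q', hq', hy', rfl⟩ := h'
  refine ⟨p * p', q * q', by simp [hq, hq'], ?_, map_mul _ _ _⟩
  rw [map_mul, map_mul, ← hy, ← hy']
  ring

theorem isAcyclicFun_val (Γ : SimpleGraph V) (C : Finset V) :
    IsAcyclicFun Γ C (fun x : C => (x : V)) := by
  refine ⟨fun _ => Or.inl rfl, fun x hx => ?_⟩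
  obtain ⟨y, ⟨h, h1, h2⟩, -⟩ := Relation.TransGen.head'_iff.1 hx
  exact h2 h1.symm

variable [Fintype V]

open Classical in
/-- The variable `Y_C` has degree `1` in `A_s` if `s ∈ C`, and degree `0` otherwise. -/
theorem exists_specializesTo_clusterVar (Γ : SimpleGraph V) (C : Finset V) (s : V) :
    ∃ P : Polynomial ℤ, SpecializesTo s (clusterVar Γ C) P ∧ P ≠ 0 ∧
      P.natDegree = if s ∈ C then 1 else 0 := by
  set F : Finset (C → V) := {f : C → V | IsAcyclicFun Γ C f} with hF
  set num : MvPolynomial (V ⊕ V) ℤ := ∑ f ∈ F, ∏ x : C,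
    (if f x = x then MvPolynomial.X (.inl (x : V)) else MvPolynomial.X (.inr (f x))) with hnum
  set den : MvPolynomial (V ⊕ V) ℤ := ∏ x ∈ C, MvPolynomial.X (.inr x) with hden
  set n : ℕ := (F.filter (fun f => ∃ h : s ∈ C, f ⟨s, h⟩ = s)).card with hn
  set m : ℕ := (F.filter (fun f => ¬ ∃ h : s ∈ C, f ⟨s, h⟩ = s)).card with hm
  have hid : (fun x : C => (x : V)) ∈ F := by
    rw [hF, Finset.mem_filter]
    exact ⟨Finset.mem_univ _, isAcyclicFun_val Γ C⟩
  have hP : specialize s num = Polynomial.C (n : ℤ) * Polynomial.X + Polynomial.C (m : ℤ) := by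
    rw [hnum, map_sum, ← Finset.sum_filter_add_sum_filter_not F
      (fun f => ∃ h : s ∈ C, f ⟨s, h⟩ = s)]
    congr 1
    · rw [Finset.sum_congr rfl (g := fun _ => Polynomial.X)]
      · simp [hn]
      · intro f hf
        obtain ⟨hs, hfs⟩ := (Finset.mem_filter.1 hf).2
        rw [map_prod, Finset.prod_eq_single ⟨s, hs⟩]
        · rw [if_pos hfs, specialize_X_inl_self]
        · intro x _ hx
          split_ifs
          · exact specialize_X_inl_of_ne fun h => hx (Subtype.ext h)
          · exact specialize_X_inr _
        · exact fun h => absurd (Finset.mem_univ _) h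
    · rw [Finset.sum_congr rfl (g := fun _ => 1)]
      · simp [hm]
      · intro f hf
        have hfs := (Finset.mem_filter.1 hf).2
        rw [map_prod]
        refine Finset.prod_eq_one fun x _ => ?_
        split_ifs with hx
        · refine specialize_X_inl_of_ne fun h => hfs ⟨h ▸ x.2, ?_⟩
          subst h
          exact hx
        · exact specialize_X_inr _
  refine ⟨specialize s num, ⟨num, den, ?_, ?_, rfl⟩, ?_⟩
  · rw [hden, map_prod]
    exact Finset.prod_eq_one fun x _ => specialize_X_inr x
  · have hne : algebraMap _ (LPField V) den ≠ 0 := by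
      rw [Ne, IsFractionRing.to_map_eq_zero_iff, hden]
      exact Finset.prod_ne_zero_iff.2 fun x _ => MvPolynomial.X_ne_zero _
    have hY : clusterVar Γ C = algebraMap _ (LPField V) num / algebraMap _ (LPField V) den := by
      rw [clusterVar, hnum, hden, map_sum, map_prod]
      congr 1
      refine Finset.sum_congr rfl fun f _ => ?_
      rw [map_prod]
      refine Finset.prod_congr rfl fun x _ => ?_
      split_ifs <;> rfl
    rw [hY, div_mul_cancel₀ _ hne]
  · rw [hP]
    by_cases hs : s ∈ C
    · have hn0 : (n : ℤ) ≠ 0 := by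
        rw [Nat.cast_ne_zero, hn]
        exact Finset.card_ne_zero.2 ⟨_, Finset.mem_filter.2 ⟨hid, hs, rfl⟩⟩
      rw [if_pos hs]
      have hdeg := Polynomial.natDegree_linear (b := (m : ℤ)) hn0
      exact ⟨fun h0 => by rw [h0] at hdeg; simp at hdeg, hdeg⟩
    · have hm0 : (m : ℤ) ≠ 0 := by
        rw [Nat.cast_ne_zero, hm]
        exact Finset.card_ne_zero.2 ⟨_, Finset.mem_filter.2 ⟨hid, fun h => hs h.1⟩⟩
      have hn0 : (n : ℤ) = 0 := by
        rw [Nat.cast_eq_zero, hn, Finset.card_eq_zero, Finset.filter_eq_empty_iff]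
        exact fun f _ h => hs h.1
      rw [if_neg hs, hn0]
      simpa using hm0

theorem clusterVar_sq_ne (Γ : SimpleGraph V) {C : Finset V} (hC : C.Nonempty) (I : Finset V) :
    clusterVar Γ C ^ 2 ≠ clusterVar Γ I := by
  classical
  obtain ⟨s, hs⟩ := hC
  obtain ⟨P, hP, hP0, hPd⟩ := exists_specializesTo_clusterVar Γ C s
  obtain ⟨Q, hQ, -, hQd⟩ := exists_specializesTo_clusterVar Γ I s
  intro h
  rw [sq] at h
  have hPQ := (h ▸ hP.mul hP).unique hQ
  rw [← hPQ, Polynomial.natDegree_mul hP0 hP0, hPd, if_pos hs] at hQd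
  split_ifs at hQd
  omega

theorem clusterVar_sq_ne_one (Γ : SimpleGraph V) {C : Finset V} (hC : C.Nonempty) :
    clusterVar Γ C ^ 2 ≠ 1 := by
  classical
  obtain ⟨s, hs⟩ := hC
  obtain ⟨P, hP, hP0, hPd⟩ := exists_specializesTo_clusterVar Γ C s
  intro h
  rw [sq] at h
  have hPQ := (h ▸ hP.mul hP).unique SpecializesTo.one
  have := congrArg Polynomial.natDegree hPQ
  rw [Polynomial.natDegree_mul hP0 hP0, hPd, if_pos hs, Polynomial.natDegree_one] at this
  omega

/-- The coefficient variables that occur in a product of variables `Y_I` are indexed by a union of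
the corresponding sets `I`. -/
theorem exists_support_of_mem_closure {Γ : SimpleGraph V} {𝓘 : Finset (Finset V)} {y : LPField V}
    (hy : y ∈ Submonoid.closure {y | ∃ I ∈ 𝓘, y = clusterVar Γ I}) :
    ∃ 𝓙 ⊆ 𝓘, ∀ s, ∃ P, SpecializesTo s y P ∧ P ≠ 0 ∧ (0 < P.natDegree ↔ ∃ J ∈ 𝓙, s ∈ J) := by
  classical
  induction hy using Submonoid.closure_induction with
  | mem y hy =>
    obtain ⟨I, hI, rfl⟩ := hy
    refine ⟨{I}, Finset.singleton_subset_iff.2 hI, fun s => ?_⟩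
    obtain ⟨P, hP, hP0, hPd⟩ := exists_specializesTo_clusterVar Γ I s
    refine ⟨P, hP, hP0, ?_⟩
    rw [hPd]
    by_cases hs : s ∈ I <;> simp [hs]
  | one => exact ⟨∅, Finset.empty_subset _, fun s => ⟨1, .one, one_ne_zero, by simp⟩⟩
  | mul y y' _ _ ih ih' =>
    obtain ⟨𝓙, h𝓙, h⟩ := ih
    obtain ⟨𝓙', h𝓙', h'⟩ := ih'
    refine ⟨𝓙 ∪ 𝓙', Finset.union_subset h𝓙 h𝓙', fun s => ?_⟩
    obtain ⟨P, hP, hP0, hPd⟩ := h s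
    obtain ⟨P', hP', hP0', hPd'⟩ := h' s
    refine ⟨P * P', hP.mul hP', mul_ne_zero hP0 hP0', ?_⟩
    rw [Polynomial.natDegree_mul hP0 hP0', Nat.add_pos_iff_pos_or_pos, hPd, hPd']
    simp only [Finset.mem_union, or_and_right, exists_or]

/-- If `Y_C ^ 2` is a product of variables `Y_I`, then `C` is the union of some of the sets `I`. -/
theorem exists_union_of_clusterVar_sq_mem {Γ : SimpleGraph V} {𝓘 : Finset (Finset V)}
    {C : Finset V}
    (hC : clusterVar Γ C ^ 2 ∈ Submonoid.closure {y | ∃ I ∈ 𝓘, y = clusterVar Γ I}) :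
    ∀ x ∈ C, ∃ J ∈ 𝓘, x ∈ J ∧ J ⊆ C := by
  classical
  obtain ⟨𝓙, h𝓙, h⟩ := exists_support_of_mem_closure hC
  have key : ∀ s, s ∈ C ↔ ∃ J ∈ 𝓙, s ∈ J := by
    intro s
    obtain ⟨Q, hQ, -, hQd⟩ := h s
    obtain ⟨P, hP, hP0, hPd⟩ := exists_specializesTo_clusterVar Γ C s
    rw [sq] at hQ
    rw [← hQd, hQ.unique (hP.mul hP), Polynomial.natDegree_mul hP0 hP0, hPd]
    by_cases hs : s ∈ C <;> simp [hs]
  intro x hx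
  obtain ⟨J, hJ, hxJ⟩ := (key x).1 hx
  exact ⟨J, h𝓙 hJ, hxJ, fun z hz => (key z).2 ⟨J, hJ, hz⟩⟩

end Degree

/-! ### Existence of arcs with square weight -/

section Geometry

variable {V : Type*} {Γ : SimpleGraph V} [Fintype V] {𝓘 : Finset (Finset V)}

/-- The path from `v` to the leaf `t` of `Γ`, prolonged to the new vertex at `t`, is contained in
the path of some admissible pair of leaves, whichever neighbour of `v` was chosen as `a₁`. -/
theorem exists_isLeafPair (hΓ : Γ.IsTree) {v a₁ a : V} (ha₁ : Γ.Adj v a₁) (ha : Γ.Adj v a)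
    (t : {l : V // IsLeaf Γ l}) (hat : a ∈ pathSet Γ v t) :
    ∃ l k, IsLeafPair Γ v a₁ l k ∧ ∀ z, (z = .inr t ∨ ∃ w ∈ pathSet Γ v t, z = .inl w) →
      z ∈ pathSet (extGraph Γ) l k := by
  have hmem : ∀ (s : {l : V // IsLeaf Γ l}) (w : V), w ∈ pathSet Γ v s →
      Sum.inl w ∈ pathSet (extGraph Γ) (.inl v) (.inr s) := by
    intro s w hw
    obtain ⟨p, hp, hps⟩ := exists_ext_isPath hΓ v s
    exact ⟨p, hp, (hps _).2 (Or.inr ⟨w, hw, rfl⟩)⟩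
  by_cases hne : a = a₁
  · subst hne
    obtain ⟨t', ht'⟩ : ∃ t' : {l : V // IsLeaf Γ l}, a ∉ pathSet Γ v t' := by
      by_cases hw : ∃ w, Γ.Adj v w ∧ w ≠ a
      · obtain ⟨w, hvw, hwa⟩ := hw
        obtain ⟨t', ht', hwt'⟩ := exists_isLeaf_beyond hΓ hvw.ne'
        exact ⟨⟨t', ht'⟩, fun h => hwa (eq_of_adj_of_mem_pathSet hΓ hvw ha hwt' h)⟩
      · -- If `a` is the only neighbour of `v` in `Γ`, then `v` carries a new vertex.
        push Not at hw
        refine ⟨⟨v, ?_⟩, fun h => ha.ne' (eq_of_mem_pathSet_self h)⟩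
        unfold IsLeaf
        rw [Set.ncard_eq_one]
        exact ⟨a, Set.eq_singleton_iff_unique_mem.2 ⟨ha, hw⟩⟩
    have htt' : t ≠ t' := fun h => ht' (h ▸ hat)
    refine ⟨.inr t, .inr t', ⟨isLeaf_ext t, isLeaf_ext t', hmem t a hat,
      fun h => ht' (mem_pathSet_of_ext h)⟩, fun z hz => mem_ext_pathSet hΓ htt'
      (fun z h h' => eq_of_mem_pathSet_of_mem_pathSet hΓ ha hat ht' h h') ?_⟩
    rcases hz with hz | ⟨w, hw, hz⟩
    · exact Or.inl hz
    · exact Or.inr (Or.inr ⟨w, hz, Or.inl hw⟩)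
  · obtain ⟨t', ht', ha₁t'⟩ := exists_isLeaf_beyond hΓ ha₁.ne'
    have ha₁t : a₁ ∉ pathSet Γ v t := fun h => hne (eq_of_adj_of_mem_pathSet hΓ ha ha₁ hat h)
    have htt' : (⟨t', ht'⟩ : {l : V // IsLeaf Γ l}) ≠ t := by
      rintro rfl
      exact ha₁t ha₁t'
    refine ⟨.inr ⟨t', ht'⟩, .inr t, ⟨isLeaf_ext _, isLeaf_ext t, hmem ⟨t', ht'⟩ a₁ ha₁t',
      fun h => ha₁t (mem_pathSet_of_ext h)⟩, fun z hz => mem_ext_pathSet hΓ htt'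
      (fun z h h' => eq_of_mem_pathSet_of_mem_pathSet hΓ ha₁ ha₁t' ha₁t h h') ?_⟩
    rcases hz with hz | ⟨w, hw, hz⟩
    · exact Or.inr (Or.inl hz)
    · exact Or.inr (Or.inr ⟨w, hz, Or.inr hw⟩)

/-- Every component `C` of `I_{j+1} ∖ [v, u]`, where `u` is the largest vertex of `I_j`, is the set
that determines the weight of some boundary arc of a triangulated polygon: a path from `v` through
`C` to a new vertex of the extended tree leaves `C` at a vertex `b` that lies outside `I_j`. -/
theorem exists_rimArc_of_isComponent (hΓ : Γ.IsTree) (h𝓘 : IsMaxNested Γ 𝓘) {v a₁ a u : V}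
    (ha₁ : Γ.Adj v a₁) (ha : IsLower Γ 𝓘 v a) {j : ℕ} (hj : 1 ≤ j)
    (hjc : j < branchLen 𝓘 v a) (hu : IsTop 𝓘 (branchSet 𝓘 v a j) u) {C : Finset V}
    (hC : IsComponent Γ ((branchSet 𝓘 v a (j + 1) : Set V) \ pathSet Γ v u) C) :
    ∃ l k b, IsLeafPair Γ v a₁ l k ∧ OnBranch Γ 𝓘 v l k a ∧
      IsExit Γ v l k (branchSet 𝓘 v a j) b ∧ IsExit Γ v l k (branchSet 𝓘 v a (j + 1)) b ∧
      RimArc Γ 𝓘 v a₁ l k (.far v (branchSet 𝓘 v a j) b) (.far v (branchSet 𝓘 v a (j + 1)) b)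
        (clusterVar Γ C ^ 2) := by
  have hI := mem_branchSets.1 (branchSet_mem h𝓘.nested hj hjc.le)
  have hI' := mem_branchSets.1 (branchSet_mem h𝓘.nested (Nat.le_add_left 1 j) hjc)
  have hsub := branchSet_subset h𝓘.nested hj (Nat.le_add_right j 1) hjc
  have hCI : ∀ y ∈ C, y ∈ branchSet 𝓘 v a (j + 1) := fun y hy => (hC.subset hy).1
  have hCp : ∀ y ∈ C, y ∉ pathSet Γ v u := fun y hy => (hC.subset hy).2
  obtain ⟨c, hc⟩ := hC.conn.nonempty
  have hcv : c ≠ v := fun h => hI'.2.2 (h ▸ hCI c hc)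
  have hac : a ∈ pathSet Γ v c :=
    (h𝓘.nested.conn _ hI'.1).mem_pathSet hI'.2.2 ha.1 hI'.2.1 (hCI c hc)
  obtain ⟨t, ht, hct⟩ := exists_isLeaf_beyond hΓ hcv
  obtain ⟨y, hy, b, hbt, hyb, hbI, hbu⟩ : ∃ y ∈ C, ∃ b : ExtVertex Γ,
      (b = .inr ⟨t, ht⟩ ∨ ∃ w ∈ pathSet Γ v t, b = .inl w) ∧ (extGraph Γ).Adj (.inl y) b ∧
      (∀ x, x = v ∨ x ∈ branchSet 𝓘 v a j → b ≠ .inl x) ∧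
      ∀ x ∈ pathSet Γ v u, ¬ (extGraph Γ).Adj (.inl x) b := by
    by_cases htC : t ∈ C
    · refine ⟨t, htC, .inr ⟨t, ht⟩, Or.inl rfl, rfl, fun x _ => Sum.inr_ne_inl,
        fun x hx hxt => ?_⟩
      have hxt' : x = t := hxt
      exact hCp t htC (hxt' ▸ hx)
    · obtain ⟨y, hy, w, hwC, hyw, hcw, hwt⟩ := exists_exit hct (C := (C : Set V)) hc htC
      -- As `c` lies on `[v, w]` but not on `[v, u]`, the path `[v, u]` does not reach `w`.
      have hwu : w ∉ pathSet Γ v u := fun h => hCp c hc (mem_pathSet_trans hΓ hcw h)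
      refine ⟨y, hy, .inl w, Or.inr ⟨w, hwt, rfl⟩, hyw, ?_, ?_⟩
      · rintro x hx h
        cases h
        rcases hx with rfl | hx
        · exact hwu (left_mem_pathSet hΓ _ u)
        · have hwne : w ≠ u := fun h => hwu (h ▸ right_mem_pathSet hΓ v w)
          exact hwC (hC.mem_of_adj hy
            ⟨mem_branchSet_succ_of_adj h𝓘 hj hjc hu (hCI y hy) hx hwne hyw, hwu⟩ hyw)
      · intro x hx hxw
        have hxw' : Γ.Adj x w := hxw
        rcases mem_pathSet_snoc hΓ hx hxw' hwu hcw with rfl | h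
        · exact hwC hc
        · exact hCp c hc h
  obtain ⟨l, k, hlk, hmem⟩ := exists_isLeafPair hΓ ha₁ ha.1 ⟨t, ht⟩
    (mem_pathSet_trans hΓ hac hct)
  have hon : OnBranch Γ 𝓘 v l k a :=
    ⟨ha, hmem _ (Or.inr ⟨a, mem_pathSet_trans hΓ hac hct, rfl⟩)⟩
  have hN : b ∈ extNbrs Γ (branchSet 𝓘 v a j) :=
    ⟨fun s hs => hbI s (Or.inr hs), y, hsub (hCI y hy), hyb⟩
  have hN' : b ∈ extNbrs Γ (branchSet 𝓘 v a (j + 1)) :=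
    ⟨fun s hs => hbI s (Or.inr (hsub hs)), y, hCI y hy, hyb⟩
  have hb : b ≠ .inl v := hbI v (Or.inl rfl)
  have hE : IsExit Γ v l k (branchSet 𝓘 v a j) b := ⟨hb, hN, hmem _ hbt⟩
  have hE' : IsExit Γ v l k (branchSet 𝓘 v a (j + 1)) b := ⟨hb, hN', hmem _ hbt⟩
  exact ⟨l, k, b, hlk, hon, hE, hE', .step_square a j b b u C hon hj hjc hE hE' hu hN'
    (fun ⟨x, hx, hxb⟩ => hbu x hx hxb) hC ⟨y, hy, hyb⟩⟩

end Geometry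

/-! ### Classification of the edge weights -/

section Weights

variable {V : Type*} {Γ : SimpleGraph V} [Fintype V] {𝓘 : Finset (Finset V)} {v a₁ : V}
  {l k : ExtVertex Γ} {p q : SVert Γ} {w : LPField V}

/-- The polygon vertices: neighbours of `v`, and ends of internal arcs labelled by a member of the
nested collection. -/
def IsRimVertex (𝓘 : Finset (Finset V)) (v : V) (p : SVert Γ) : Prop :=
  (∃ x, p = .tip v x) ∨ ∃ I ∈ 𝓘, ∃ b, p = .far v I b

theorem isRimVertex_far (h𝓘 : IsMaxNested Γ 𝓘) {a : V} {j : ℕ} (hj : 1 ≤ j)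
    (hjc : j ≤ branchLen 𝓘 v a) (b : ExtVertex Γ) :
    IsRimVertex 𝓘 v (.far v (branchSet 𝓘 v a j) b) :=
  Or.inr ⟨_, (mem_branchSets.1 (branchSet_mem h𝓘.nested hj hjc)).1, b, rfl⟩

theorem RimArc.isRimVertex (h𝓘 : IsMaxNested Γ 𝓘) (ha₁ : IsLower Γ 𝓘 v a₁)
    (h : RimArc Γ 𝓘 v a₁ l k p q w) : IsRimVertex 𝓘 v p ∧ IsRimVertex 𝓘 v q := by
  cases h with
  | tip_adj a b ha hb hadj =>
    exact ⟨Or.inl ⟨_, rfl⟩, isRimVertex_far h𝓘 (ha.1.one_le_branchLen h𝓘) le_rfl b⟩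
  | tip_cover a b z ha hb hadj hz hbz =>
    exact ⟨Or.inl ⟨_, rfl⟩, isRimVertex_far h𝓘 (ha.1.one_le_branchLen h𝓘) le_rfl b⟩
  | step_adj a j b b' u ha hj hjc hb hb' hu hadj =>
    exact ⟨isRimVertex_far h𝓘 hj hjc.le b, isRimVertex_far h𝓘 (Nat.le_add_left 1 j) hjc b'⟩
  | step_cover a j b b' u w z ha hj hjc hb hb' hu hw hz hzw hbz =>
    exact ⟨isRimVertex_far h𝓘 hj hjc.le b, isRimVertex_far h𝓘 (Nat.le_add_left 1 j) hjc b'⟩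
  | step_one a j b b' u ha hj hjc hb hb' hu hbn hadj =>
    exact ⟨isRimVertex_far h𝓘 hj hjc.le b, isRimVertex_far h𝓘 (Nat.le_add_left 1 j) hjc b'⟩
  | step_square a j b b' u C ha hj hjc hb hb' hu hbn hadj hC hCb =>
    exact ⟨isRimVertex_far h𝓘 hj hjc.le b, isRimVertex_far h𝓘 (Nat.le_add_left 1 j) hjc b'⟩
  | cap_lower a b b' ha hne hb hb' =>
    exact ⟨isRimVertex_far h𝓘 le_rfl (ha₁.one_le_branchLen h𝓘) b,
      isRimVertex_far h𝓘 le_rfl (ha.1.one_le_branchLen h𝓘) b'⟩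
  | cap_greater x b hx hxg hxp hb =>
    exact ⟨isRimVertex_far h𝓘 le_rfl (ha₁.one_le_branchLen h𝓘) b, Or.inl ⟨_, rfl⟩⟩

/-- The weight is `1` or a variable of the cluster. -/
def IsClusterWeight (Γ : SimpleGraph V) (𝓘 : Finset (Finset V)) (w : LPField V) : Prop :=
  w = 1 ∨ ∃ I ∈ 𝓘, w = clusterVar Γ I

theorem IsRimVertex.spokeWeight (h : IsRimVertex 𝓘 v p) :
    IsClusterWeight Γ 𝓘 (spokeWeight Γ p) := by
  rcases h with ⟨x, rfl⟩ | ⟨I, hI, b, rfl⟩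
  · exact Or.inl rfl
  · exact Or.inr ⟨I, hI, rfl⟩

/-- An edge `(b_{i,j}, b_{i,j+1})` of a component snake graph whose weight is the square `Y_C ^ 2`
for a component `C` of `I^i_{j+1} ∖ [v, a^i_j]`, where `a = a_i` and `u = a^i_j`. -/
structure IsSquareEdge (Γ : SimpleGraph V) (𝓘 : Finset (Finset V)) (v a₁ a : V) (j : ℕ) (u : V)
    (C : Finset V) (e : Set (SVert Γ) × LPField V) : Prop where
  lower : IsLower Γ 𝓘 v a
  one_le : 1 ≤ j
  lt : j < branchLen 𝓘 v a
  top : IsTop 𝓘 (branchSet 𝓘 v a j) u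
  comp : IsComponent Γ ((branchSet 𝓘 v a (j + 1) : Set V) \ pathSet Γ v u) C
  weight : e.2 = clusterVar Γ C ^ 2
  ends : ∃ l k b b', IsLeafPair Γ v a₁ l k ∧ OnBranch Γ 𝓘 v l k a ∧
    IsExit Γ v l k (branchSet 𝓘 v a j) b ∧ IsExit Γ v l k (branchSet 𝓘 v a (j + 1)) b' ∧
    e.1 = {.far v (branchSet 𝓘 v a j) b, .far v (branchSet 𝓘 v a (j + 1)) b'}

theorem isClusterWeight_or_isSquareEdge (h𝓘 : IsMaxNested Γ 𝓘) (ha₁ : IsLower Γ 𝓘 v a₁)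
    {e : Set (SVert Γ) × LPField V} (he : e ∈ rawEdges Γ 𝓘 v a₁) :
    IsClusterWeight Γ 𝓘 e.2 ∨ ∃ a j u C, IsSquareEdge Γ 𝓘 v a₁ a j u C e := by
  obtain ⟨l, k, hlk, p, q, h, hpq⟩ := he
  obtain ⟨E, w⟩ := e
  simp only at h hpq
  cases h with
  | spoke_right h => exact Or.inl (h.isRimVertex h𝓘 ha₁).2.spokeWeight
  | spoke_left h => exact Or.inl (h.isRimVertex h𝓘 ha₁).1.spokeWeight
  | rim h =>
    cases h with
    | tip_adj => exact Or.inl (Or.inl rfl)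
    | tip_cover a b z => exact Or.inl (Or.inr ⟨_, h𝓘.minSet_mem z, rfl⟩)
    | step_adj => exact Or.inl (Or.inl rfl)
    | step_cover a j b b' u w z => exact Or.inl (Or.inr ⟨_, h𝓘.minSet_mem z, rfl⟩)
    | step_one => exact Or.inl (Or.inl rfl)
    | step_square a j b b' u C ha hj hjc hb hb' hu hbn hadj hC hCb =>
      exact Or.inr ⟨a, j, u, C, ha.1, hj, hjc, hu, hC, rfl, l, k, b, b', hlk, ha, hb, hb', hpq⟩
    | cap_lower => exact Or.inl (Or.inr ⟨_, h𝓘.minSet_mem v, rfl⟩)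
    | cap_greater => exact Or.inl (Or.inr ⟨_, h𝓘.minSet_mem v, rfl⟩)

theorem IsClusterWeight.ne_sq {w : LPField V} (h : IsClusterWeight Γ 𝓘 w) {C : Finset V}
    (hC : C.Nonempty) : w ≠ clusterVar Γ C ^ 2 := by
  rcases h with rfl | ⟨I, -, rfl⟩
  · exact (clusterVar_sq_ne_one Γ hC).symm
  · exact (clusterVar_sq_ne Γ hC I).symm

theorem IsClusterWeight.mem_closure {w : LPField V} (h : IsClusterWeight Γ 𝓘 w) :
    w ∈ Submonoid.closure {y | ∃ I ∈ 𝓘, y = clusterVar Γ I} := by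
  rcases h with rfl | h
  · exact one_mem _
  · exact Submonoid.subset_closure h

end Weights

/-! ### Square weights under trimming -/

section Trimming

variable {V : Type*} {Γ : SimpleGraph V} [Fintype V] {𝓘 : Finset (Finset V)} {S : Finset V}
  {v a₁ a : V}

/-- The label of a diagonal that meets an edge without apex is the label of one of its ends. -/
theorem exists_far_of_meet {d : Finset V × Set (SVert Γ)}
    (hd : d ∈ singletonDiagonals Γ 𝓘 v a₁) {E : Set (SVert Γ)} (hm : (d.2 ∩ E).Nonempty)
    (hE : ∀ x ∈ E, ∃ I b, x = .far v I b) : ∃ b, .far v d.1 b ∈ E := by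
  obtain ⟨x, hxd, hxE⟩ := hm
  obtain ⟨I, b, rfl⟩ := hE x hxE
  obtain ⟨a, -, -, hd2⟩ := hd
  rw [hd2] at hxd
  obtain ⟨l, k, -, -, h | ⟨b', -, h⟩⟩ := hxd
  · unfold apexOf at h
    split_ifs at h
  · cases h
    exact ⟨b, hxE⟩

theorem exists_mem_singletonDiagonals (ha : IsLower Γ 𝓘 v a) {I : Finset V}
    (hI : I ∈ branchSets 𝓘 v a) : ∃ d ∈ singletonDiagonals Γ 𝓘 v a₁, d.1 = I ∧
      ∀ l k b, IsLeafPair Γ v a₁ l k → OnBranch Γ 𝓘 v l k a → IsExit Γ v l k I b →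
        .far v I b ∈ d.2 :=
  ⟨(I, {x | ∃ l k, IsLeafPair Γ v a₁ l k ∧ OnBranch Γ 𝓘 v l k a ∧
    (x = apexOf Γ 𝓘 v a₁ I ∨ ∃ b, IsExit Γ v l k I b ∧ x = .far v I b)}), ⟨a, ha, hI, rfl⟩, rfl,
    fun l k b hlk hon hb => ⟨l, k, hlk, hon, Or.inr ⟨b, hb, rfl⟩⟩⟩

/-- An edge of weight `Y_C ^ 2` between the tiles `I_j` and `I_{j+1}` is deleted in the trimming
if `I_j ⊆ S`. -/
theorem not_subset_of_mem_keptEdges (h𝓘 : IsMaxNested Γ 𝓘) (hS : S ∉ 𝓘) {j : ℕ} {u : V}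
    {C : Finset V} {e f : Set (SVert Γ) × LPField V} (he : IsSquareEdge Γ 𝓘 v a₁ a j u C e)
    (hef : e.1 ⊆ f.1) (hf : f ∈ keptEdges Γ 𝓘 S v a₁) : ¬ branchSet 𝓘 v a j ⊆ S := by
  intro hjS
  have hI := mem_branchSets.1 (branchSet_mem h𝓘.nested he.one_le he.lt.le)
  have hss : branchSet 𝓘 v a j ⊂ S :=
    hjS.ssubset_of_ne fun h => hS (h ▸ hI.1)
  obtain ⟨m, hm, hmin⟩ : ∃ m, IsLeast {n | 1 ≤ n ∧ n ≤ branchLen 𝓘 v a ∧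
      branchSet 𝓘 v a n ⊂ S} m := by
    classical
    have hex : ∃ n, 1 ≤ n ∧ n ≤ branchLen 𝓘 v a ∧ branchSet 𝓘 v a n ⊂ S :=
      ⟨j, he.one_le, he.lt.le, hss⟩
    exact ⟨Nat.find hex, Nat.find_spec hex, fun n hn => Nat.find_min' hex hn⟩
  have hmj : m ≤ j := hmin ⟨he.one_le, he.lt.le, hss⟩
  have haS : a ∉ rootedPortion 𝓘 S := by
    simp only [rootedPortion, Finset.mem_filter, not_and, not_not]
    exact fun _ => (minSet_subset hI.1 hI.2.1).trans hjS
  refine hf.2 a m ⟨he.lower, hjS hI.2.1, haS, hm, hmin⟩ (Or.inl ?_)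
  obtain ⟨l, k, b, b', hlk, hon, -, hb', hends⟩ := he.ends
  obtain ⟨d, hd, hdI, hdfar⟩ := exists_mem_singletonDiagonals (a₁ := a₁) he.lower
    (branchSet_mem h𝓘.nested (Nat.le_add_left 1 j) he.lt)
  refine ⟨d, hd, ?_, .far v (branchSet 𝓘 v a (j + 1)) b', hdfar l k b' hlk hon hb', hef ?_⟩
  · rw [hdI, branchSet_ssubset_iff h𝓘.nested (Nat.le_add_left 1 j) he.lt hm.1 hm.2.1]
    omega
  · rw [hends]
    exact Or.inr rfl

/-- An edge of weight `Y_C ^ 2` between the tiles `I_j` and `I_{j+1}` survives the trimming if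
`I_j ⊈ S`. -/
theorem exists_mem_trimmedGraph_edges (hΓ : Γ.IsTree) (h𝓘 : IsMaxNested Γ 𝓘)
    (ha₁ : IsLower Γ 𝓘 v a₁) {j : ℕ} {u : V} {C : Finset V} {e : Set (SVert Γ) × LPField V}
    (he : IsSquareEdge Γ 𝓘 v a₁ a j u C e) (hraw : e ∈ rawEdges Γ 𝓘 v a₁)
    (hjS : ¬ branchSet 𝓘 v a j ⊆ S) :
    ∃ f ∈ (trimmedGraph Γ 𝓘 S v a₁).edges, f.2 = clusterVar Γ C ^ 2 := by
  have hCne : C.Nonempty := he.comp.conn.nonempty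
  -- All edges of weight `Y_C ^ 2` join vertices of the form `b_{i,j}`.
  have hfar : ∀ e' ∈ rawEdges Γ 𝓘 v a₁, e'.2 = clusterVar Γ C ^ 2 →
      ∀ x ∈ e'.1, ∃ I b, x = .far v I b := by
    intro e' he' hw x hx
    rcases isClusterWeight_or_isSquareEdge h𝓘 ha₁ he' with h | ⟨a', j', u', C', h⟩
    · exact absurd hw (h.ne_sq hCne)
    · obtain ⟨l, k, b, b', -, -, -, -, hends⟩ := h.ends
      rw [hends] at hx
      rcases hx with rfl | rfl
      · exact ⟨_, _, rfl⟩
      · exact ⟨_, _, rfl⟩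
  set f : Set (SVert Γ) × LPField V := (e.1 ∪ {x | ∃ e' ∈ rawEdges Γ 𝓘 v a₁,
    Combinable Γ 𝓘 v a₁ e e' ∧ x ∈ e'.1}, e.2) with hf
  have hffar : ∀ x ∈ f.1, ∃ I b, x = .far v I b := by
    rintro x (hx | ⟨e', he', hc, hx⟩)
    · exact hfar e hraw he.weight x hx
    · exact hfar e' he' (hc.1.trans he.weight) x hx
  have hlabel : ∀ d ∈ singletonDiagonals Γ 𝓘 v a₁, (d.2 ∩ f.1).Nonempty →
      d.1 = branchSet 𝓘 v a j ∨ d.1 = branchSet 𝓘 v a (j + 1) := by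
    have key : ∀ d ∈ singletonDiagonals Γ 𝓘 v a₁, (d.2 ∩ e.1).Nonempty →
        d.1 = branchSet 𝓘 v a j ∨ d.1 = branchSet 𝓘 v a (j + 1) := by
      intro d hd hm
      obtain ⟨b₀, hb₀⟩ := exists_far_of_meet hd hm (hfar e hraw he.weight)
      obtain ⟨l, k, b, b', -, -, -, -, hends⟩ := he.ends
      rw [hends] at hb₀
      rcases hb₀ with h | h
      · exact Or.inl (SnakeVertex.far.inj h).2.1
      · exact Or.inr (SnakeVertex.far.inj h).2.1
    rintro d hd ⟨x, hxd, hx | ⟨e', he', hc, hx⟩⟩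
    · exact key d hd ⟨x, hxd, hx⟩
    · rcases hc.2.2 with hml | hw
      · have hd1 : d.1 ∈ meetingLabels (singletonDiagonals Γ 𝓘 v a₁) e'.1 :=
          ⟨d, hd, rfl, x, hxd, hx⟩
        rw [hml] at hd1
        obtain ⟨d', hd', hdd', hm⟩ := hd1
        rw [← hdd']
        exact key d' hd' hm
      · exact absurd (he.weight.symm.trans hw) (clusterVar_sq_ne Γ hCne _)
  refine ⟨f, ⟨⟨⟨e, hraw, rfl, rfl⟩, ?_⟩, ?_⟩, he.weight⟩
  · rintro a' m ⟨hlow, -, -, ⟨hm1, hmc, hmS⟩, -⟩ hcut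
    rcases hcut with ⟨d, hd, hdm, hmeet⟩ | ⟨-, u', -, htip⟩
    · have hdI := hlabel d hd hmeet
      have hI := mem_branchSets.1 (branchSet_mem h𝓘.nested he.one_le he.lt.le)
      have hI' := mem_branchSets.1 (branchSet_mem h𝓘.nested (Nat.le_add_left 1 j) he.lt)
      have had : a ∈ d.1 := by
        rcases hdI with h | h
        · exact h ▸ hI.2.1
        · exact h ▸ hI'.2.1
      have hM := mem_branchSets.1 (branchSet_mem h𝓘.nested hm1 hmc)
      -- A member that avoids `v` meets one branch at `v` only.
      have haa' : a' = a := (h𝓘.nested.conn _ hM.1).eq_of_adj hΓ hM.2.2 hlow.1 he.lower.1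
        hM.2.1 (hdm.subset had)
      subst haa'
      have hmj : m ≤ j := by
        rcases hdI with h | h
        · rw [h, branchSet_ssubset_iff h𝓘.nested he.one_le he.lt.le hm1 hmc] at hdm
          exact hdm.le
        · rw [h, branchSet_ssubset_iff h𝓘.nested (Nat.le_add_left 1 j) he.lt hm1 hmc] at hdm
          exact Nat.lt_succ_iff.1 hdm
      exact hjS ((branchSet_subset h𝓘.nested hm1 hmj he.lt.le).trans hmS.subset)
    · obtain ⟨I, b, h⟩ := hffar _ htip
      cases h
  · intro x hx h0
    obtain ⟨I, b, rfl⟩ := hffar x hx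
    -- Only copies of `v` lose valence, and all other vertices start with first coordinate `1`.
    have hempty : {a | ∃ m, IsTrimmed Γ 𝓘 S v a m ∧
        (.far v I b : SVert Γ) = apexOf Γ 𝓘 v a₁ (branchSet 𝓘 v a m)} = ∅ := by
      rw [Set.eq_empty_iff_forall_notMem]
      rintro a' ⟨m, -, h⟩
      unfold apexOf at h
      split_ifs at h
    have h1 := congrArg Prod.fst h0
    simp [trimmedValence, hempty, singletonGraph] at h1

end Trimming

end GraphLP

theorem theorem5p1 {V : Type*} [Fintype V] (Γ : SimpleGraph V) (hΓ : Γ.IsTree)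
    (𝓘 : Finset (Finset V)) (h𝓘 : GraphLP.IsMaxNested Γ 𝓘)
    (S : Finset V) (hS : GraphLP.IsWeaklyRooted Γ 𝓘 S)
    (a₁ : V → V) (ha₁ : ∀ v ∈ GraphLP.rootedPortion 𝓘 S, GraphLP.IsLower Γ 𝓘 v (a₁ v)) :
    (∀ e ∈ (GraphLP.snakeGraph Γ 𝓘 S a₁).edges,
        e.2 ∈ Submonoid.closure {y | ∃ I ∈ 𝓘, y = GraphLP.clusterVar Γ I}) ↔
      ∀ v ∈ GraphLP.rootedPortion 𝓘 S, ∀ a, GraphLP.IsLower Γ 𝓘 v a →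
        ∀ j, 1 ≤ j → j < GraphLP.branchLen 𝓘 v a → ¬ GraphLP.branchSet 𝓘 v a j ⊆ S →
          ∀ u, GraphLP.IsTop 𝓘 (GraphLP.branchSet 𝓘 v a j) u →
            ∀ C : Finset V,
              GraphLP.IsComponent Γ
                ((GraphLP.branchSet 𝓘 v a (j + 1) : Set V) \ GraphLP.pathSet Γ v u) C →
              C ∈ 𝓘 := by
  by_cases hSI : S ∈ 𝓘
  · rw [GraphLP.snakeGraph, if_pos hSI]
    constructor
    · -- The rooted portion of a member of `𝓘` is empty.
      intro _ v hv
      simp only [GraphLP.rootedPortion, Finset.mem_filter] at hv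
      exact absurd (GraphLP.minSet_subset hSI hv.1) hv.2
    · rintro - e rfl
      exact Submonoid.subset_closure ⟨S, hSI, rfl⟩
  · rw [GraphLP.snakeGraph, if_neg hSI]
    constructor
    · intro h v hv a ha j hj hjc hjS u hu C hC
      obtain ⟨l, k, b, hlk, hon, hb, hb', harc⟩ :=
        GraphLP.exists_rimArc_of_isComponent hΓ h𝓘 (ha₁ v hv).1 ha hj hjc hu hC
      have hsq : GraphLP.IsSquareEdge Γ 𝓘 v (a₁ v) a j u C
          ({.far v (GraphLP.branchSet 𝓘 v a j) b, .far v (GraphLP.branchSet 𝓘 v a (j + 1)) b},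
            GraphLP.clusterVar Γ C ^ 2) :=
        ⟨ha, hj, hjc, hu, hC, rfl, l, k, b, b, hlk, hon, hb, hb', rfl⟩
      obtain ⟨f, hf, hfw⟩ := GraphLP.exists_mem_trimmedGraph_edges hΓ h𝓘 (ha₁ v hv) hsq
        ⟨l, k, hlk, _, _, .rim harc, rfl⟩ hjS
      have hmem := h _ ⟨v, hv, f, hf, rfl⟩
      simp only [hfw] at hmem
      exact h𝓘.nested.mem_of_union hC.conn (GraphLP.exists_union_of_clusterVar_sq_mem hmem)
    · rintro h f ⟨v, hv, f, hf, rfl⟩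
      obtain ⟨e, he, hfe, hef⟩ := hf.1.1
      simp only [hfe]
      rcases GraphLP.isClusterWeight_or_isSquareEdge h𝓘 (ha₁ v hv) he with hw | ⟨a, j, u, C, hsq⟩
      · exact hw.mem_closure
      · have hjS := GraphLP.not_subset_of_mem_keptEdges h𝓘 hSI hsq
          (by rw [hef]; exact Set.subset_union_left) hf.1
        have hCI := h v hv a hsq.lower j hsq.one_le hsq.lt hjS u hsq.top C hsq.comp
        rw [hsq.weight]
        have hC : GraphLP.IsClusterWeight Γ 𝓘 (GraphLP.clusterVar Γ C) := Or.inr ⟨C, hCI, rfl⟩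
        exact pow_mem hC.mem_closure 2
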